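/- Let $\Omega\subset\mathbb{R}^3$ be a bounded open set with $\Omega=\operatorname{int}\overline\Omega$ (for instance a polyhedral Lipschitz domain), let $\mathcal{G}$ be a finite regular tetrahedral mesh of $\Omega$ (closed tetrahedra with union $\overline\Omega$, no hanging nodes), and let $p\ge 1$. Let $\mathcal F_\Omega$, $\mathcal E_\Omega$ be the sets of (closed, triangular) facets and of edges not contained in $\partial\Omega$, and $\mathcal V_\Omega$ the set of mesh vertices lying in $\Omega$. The nodal points of order $p$ are the points of the tetrahedra $K\in\mathcal G$ all of whose barycentric coordinates lie in $\frac1p\mathbb{Z}$. Functions on $\Omega$ are identified if they agree almost everywhere, and "piecewise" means "on the interior of each tetrahedron". Conforming functions. $S^p_{\mathcal G,\mathrm c}$ is the space of functions in $C^0(\overline\Omega)\cap H^1_0(\Omega)$ which are polynomials of degree $\le p$ on each $K\in\mathcal G$. For a nodal point $\mathbf N$, $B^{\mathcal G}_{p,\mathbf N}$ is the continuous function, polynomial of degree $\le p$ on each $K$, with value $1$ at $\mathbf N$ and $0$ at all other nodal points. $\tilde S^p_{\mathcal G,\mathrm c}$ is the span of those $B^{\mathcal G}_{p,\mathbf N}$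 for which $\mathbf N\in\Omega$ lies in the relative interior of an edge in $\mathcal E_\Omega$, of a facet in $\mathcal F_\Omega$, or of a tetrahedron in $\mathcal G$ (the vertex functions are left out). Orthogonal polynomials. On the triangle $\widehat T$ with vertices $(0,0),(1,0),(0,1)$ put, with the Jacobi polynomials $P_n^{(\alpha,\beta)}$, $$b_{p,k}(x_1,x_2)=(x_1+x_2)^kP^{(0,2k+1)}_{p-k}\bigl(2(x_1+x_2)-1\bigr)P_k^{(0,0)}\Bigl(\tfrac{x_1-x_2}{x_1+x_2}\Bigr),\qquad 0\le k\le p,$$ $$b^{\mathrm{refl}}_{p,k}(x_1,x_2)=\tfrac13\bigl(2b_{p,2k}(x_1,x_2)-b_{p,2k}(x_2,1-x_1-x_2)-b_{p,2k}(1-x_1-x_2,x_1)\bigr),\qquad 0\le k<\lfloor\tfrac{p+2}3\rfloor,$$ and $b^{\mathrm{sym}}_{p,k}=r_{p,p-2k}$ for $p$ even, $b^{\mathrm{sym}}_{p,k}=r_{p,p-1-2k}$ for $p$ odd, $0\le k<\lfloor\frac p2\rfloor-\lfloor\frac{p-1}3\rfloor$, where $r_{p,2m}=2\sum_{0\le j\le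 p/2}M^{(p)}_{2j,2m}b_{p,2j}+b_{p,2m}$ and $$M^{(p)}_{i,j}=(-1)^p\,\frac{2i+1}{p+1}\sum_{m=0}^{i}\frac{(-j)_m(j+1)_m(-i)_m(i+1)_m}{(-p)_m(p+2)_m(1)_m\,m!}.$$ The polynomials $b^{\mathrm{sym}}_{p,k}$ are invariant under all affine symmetries of $\widehat T$, and $b^{\mathrm{refl}}_{p,k}(x_1,x_2)=b^{\mathrm{refl}}_{p,k}(x_2,x_1)$. Non-conforming functions. For $K\in\mathcal G$, $B^{K,\mathrm{nc}}_{p,k}$ vanishes outside $K$ and is on $K$ the polynomial of degree $\le p$ whose values at the nodal points on each facet $T$ of $K$ are those of $b^{\mathrm{sym}}_{p,k}\circ\chi_T^{-1}$, with an affine bijection $\chi_T:\widehat T\to T$, and whose values at the nodal points in the interior of $K$ are $0$. For $T\in\mathcal F_\Omega$, $B^{T,\mathrm{nc}}_{p,k}$ vanishes outside the two tetrahedra which have $T$ as a facet; on each such tetrahedron $K$, with $\mathbf V_K$ its vertex opposite to $T$, it is the polynomial of degree $\le p$ whose values at the nodal points on each facet $\tilde T\ne T$ of $K$ are those of $b^{\mathrm{refl}}_{p,k}\circ\chi_{\tilde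 T}^{-1}$, with an affine bijection $\chi_{\tilde T}:\widehat T\to\tilde T$ such that $\chi_{\tilde T}(0,0)=\mathbf V_K$, and whose values at all other nodal points of $K$ are $0$. Let $S^p_{\mathrm{sym,nc}}$ be the span of all $B^{K,\mathrm{nc}}_{p,k}$ ($K\in\mathcal G$, $0\le k<\lfloor\frac p2\rfloor-\lfloor\frac{p-1}3\rfloor$), $S^p_{\mathrm{refl,nc}}$ the span of all $B^{T,\mathrm{nc}}_{p,k}$ ($T\in\mathcal F_\Omega$, $0\le k<\lfloor\frac{p+2}3\rfloor$), and $S^{p,0}_{\mathrm{refl,nc}}$ the span of the $B^{T,\mathrm{nc}}_{p,0}$ ($T\in\mathcal F_\Omega$). Proposition. For every interior vertex $\mathbf V\in\mathcal V_\Omega$: 1. $B^{\mathcal G}_{p,\mathbf V}\in S^p_{\mathrm{sym,nc}}+S^{p,0}_{\mathrm{refl,nc}}+\tilde S^p_{\mathcal G,\mathrm c}$. 2. More precisely, there is a real number $c\neq0$ such that the function $$u_{\mathbf V}=c\sum_{T\in\mathcal F_\Omega,\ \mathbf V\in T}B^{T,\mathrm{nc}}_{p,0}$$ belongs to $S^p_{\mathcal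 G,\mathrm c}$ (in particular it is continuous and vanishes on $\partial\Omega$), equals $1$ at $\mathbf V$ and $0$ at every other vertex of the mesh, and satisfies $B^{\mathcal G}_{p,\mathbf V}-u_{\mathbf V}\in\tilde S^p_{\mathcal G,\mathrm c}$. Consequently, if $\mathcal V_\Omega\neq\emptyset$, then $S^p_{\mathcal G,\mathrm c}\cap S^p_{\mathrm{refl,nc}}\neq\{0\}$, that is, the sum $S^p_{\mathcal G,\mathrm c}+S^p_{\mathrm{refl,nc}}$ is not direct. -/

import Mathlib

open MeasureTheory Filter Topology
open scoped ContDiff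

noncomputable section

/-- Three-dimensional Euclidean space. -/
abbrev E3 : Type := EuclideanSpace ℝ (Fin 3)

/-! ### Orthogonal polynomials on the reference triangle -/

namespace CrouzeixRaviart

/-- The shifted factorial `a (a + 1) ⋯ (a + n - 1)`. -/
def poch (a : ℝ) (n : ℕ) : ℝ := (ascPochhammer ℝ n).eval a

/-- The Jacobi polynomial `P_n^(α,β)`, by its terminating hypergeometric series. -/
def jacobi (n : ℕ) (α β x : ℝ) : ℝ :=
  poch (α + 1) n / (n.factorial : ℝ) *
    ∑ k ∈ Finset.range (n + 1),
      poch (-(n : ℝ)) k * poch ((n : ℝ) + α + β + 1) k /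
        (poch (α + 1) k * (k.factorial : ℝ)) * ((1 - x) / 2) ^ k

/-- The orthogonal polynomials `b_{n,k}` on the reference triangle with vertices
`(0,0)`, `(1,0)`, `(0,1)`. On this triangle `x₁ + x₂ = 0` only at the origin, where the convention
`0 / 0 = 0` gives the value of the polynomial: the factor `(x₁ + x₂) ^ k` vanishes for `k ≥ 1`, and
the last factor is constant for `k = 0`. -/
def bPoly (n k : ℕ) (x₁ x₂ : ℝ) : ℝ :=
  (x₁ + x₂) ^ k * jacobi (n - k) 0 (2 * (k : ℝ) + 1) (2 * (x₁ + x₂) - 1) *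
    jacobi k 0 0 ((x₁ - x₂) / (x₁ + x₂))

/-- The coefficients `M_{i,j}^(p)`, where the `₄F₃`-sum terminates at the index `i`. -/
def coeffM (p i j : ℕ) : ℝ :=
  (-1) ^ p *
    (∑ m ∈ Finset.range (i + 1),
      poch (-(j : ℝ)) m * poch ((j : ℝ) + 1) m * poch (-(i : ℝ)) m * poch ((i : ℝ) + 1) m /
        (poch (-(p : ℝ)) m * poch ((p : ℝ) + 2) m * poch 1 m * (m.factorial : ℝ))) *
    ((2 * (i : ℝ) + 1) / ((p : ℝ) + 1))

/-- The polynomials `r_{p,m}`, for even `m ≤ p`. -/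
def rPoly (p m : ℕ) (x₁ x₂ : ℝ) : ℝ :=
  2 * ∑ j ∈ Finset.range (p / 2 + 1), coeffM p (2 * j) m * bPoly p (2 * j) x₁ x₂ + bPoly p m x₁ x₂

/-- The number `⌊p/2⌋ - ⌊(p-1)/3⌋` of totally symmetric orthogonal polynomials (`p ≥ 1`). -/
def dTriv (p : ℕ) : ℕ := p / 2 - (p - 1) / 3

/-- The number `⌊(p+2)/3⌋` of orthogonal polynomials of reflection type. -/
def dRefl (p : ℕ) : ℕ := (p + 2) / 3

/-- The totally symmetric orthogonal polynomials `b_{p,k}^sym`, `k < dTriv p`. -/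
def bSym (p k : ℕ) (x₁ x₂ : ℝ) : ℝ :=
  if Even p then rPoly p (p - 2 * k) x₁ x₂ else rPoly p (p - 1 - 2 * k) x₁ x₂

/-- The orthogonal polynomials of reflection type `b_{p,k}^refl`, `k < dRefl p`. -/
def bRefl (p k : ℕ) (x₁ x₂ : ℝ) : ℝ :=
  1 / 3 * (2 * bPoly p (2 * k) x₁ x₂ - bPoly p (2 * k) x₂ (1 - x₁ - x₂) -
    bPoly p (2 * k) (1 - x₁ - x₂) x₁)

/-! ### Barycentric coordinates, nodal points and Lagrange shape functions of a tetrahedron -/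

open Classical in
/-- The barycentric coordinate of `x` that belongs to the vertex `v` of the tetrahedron with vertex
set `K` (and `0` if `K` is not the vertex set of a tetrahedron or `v ∉ K`). -/
def bary (K : Finset E3) (v x : E3) : ℝ :=
  if h : (AffineIndependent ℝ (fun i : K => (i : E3)) ∧
      affineSpan ℝ (Set.range (fun i : K => (i : E3))) = ⊤) ∧ v ∈ K then
    (AffineBasis.mk (fun i : K => (i : E3)) h.1.1 h.1.2).coord ⟨v, h.2⟩ x
  else 0

lemma continuous_bary (K : Finset E3) (v : E3) : Continuous (bary K v) := by
  unfold bary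
  split_ifs with h
  · exact AffineMap.continuous_of_finiteDimensional _
  · exact continuous_const

/-- The point with barycentric coordinates `α v / p` in the simplex with vertex set `K`. -/
def node (p : ℕ) (K : Finset E3) (α : E3 → ℕ) : E3 := ∑ v ∈ K, ((α v : ℝ) / (p : ℝ)) • v

open Classical in
/-- The multi-indices `α : K → ℕ` of sum `p`; they index the nodal points `node p K α` of `K`. -/
def multiIndices (p : ℕ) (K : Finset E3) : Finset (E3 → ℕ) := Finset.piAntidiag K p

/-- The Lagrange shape function on the tetrahedron `K`: the polynomial of degree at most `p` which
is `1` at the nodal point with multi-index `α` and `0` at all other nodal points of `K`. -/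
def shape (p : ℕ) (K : Finset E3) (α : E3 → ℕ) (x : E3) : ℝ :=
  ∏ v ∈ K, ∏ j ∈ Finset.range (α v),
    ((p : ℝ) * bary K v x - (j : ℝ)) / ((α v : ℝ) - (j : ℝ))

lemma continuous_shape (p : ℕ) (K : Finset E3) (α : E3 → ℕ) : Continuous (shape p K α) := by
  unfold shape
  refine continuous_finsetProd _ fun v _ => continuous_finsetProd _ fun j _ => ?_
  exact ((continuous_const.mul (continuous_bary K v)).sub continuous_const).div_const _

/-! ### The Sobolev space `H₀¹` -/

/-- The partial derivative `∂f/∂xᵢ`. -/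
def partialDeriv (i : Fin 3) (f : E3 → ℝ) (x : E3) : ℝ := fderiv ℝ f x (EuclideanSpace.single i 1)

/-- `f ∈ H₀¹(Ω)`: there are smooth functions with compact support in `Ω` which converge to `f` in
`L²(Ω)` and whose first partial derivatives converge in `L²(Ω)`. -/
def MemH10 (Ω : Set E3) (f : E3 → ℝ) : Prop :=
  MemLp f 2 (volume.restrict Ω) ∧
  ∃ g : Fin 3 → E3 → ℝ, (∀ i, MemLp (g i) 2 (volume.restrict Ω)) ∧
    ∃ φ : ℕ → E3 → ℝ,
      (∀ n, ContDiff ℝ ∞ (φ n) ∧ HasCompactSupport (φ n) ∧ tsupport (φ n) ⊆ Ω) ∧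
      Tendsto (fun n => eLpNorm (φ n - f) 2 (volume.restrict Ω)) atTop (𝓝 0) ∧
      ∀ i, Tendsto (fun n => eLpNorm (partialDeriv i (φ n) - g i) 2 (volume.restrict Ω))
        atTop (𝓝 0)

lemma continuous_partialDeriv {f : E3 → ℝ} (hf : ContDiff ℝ ∞ f) (i : Fin 3) :
    Continuous (partialDeriv i f) :=
  (hf.continuous_fderiv (by simp)).clm_apply continuous_const

lemma partialDeriv_add {f g : E3 → ℝ} (hf : ContDiff ℝ ∞ f) (hg : ContDiff ℝ ∞ g) (i : Fin 3) :
    partialDeriv i (f + g) = partialDeriv i f + partialDeriv i g := by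
  funext x
  unfold partialDeriv
  rw [fderiv_add (hf.differentiable (by simp) x) (hg.differentiable (by simp) x)]
  rfl

lemma partialDeriv_smul {f : E3 → ℝ} (a : ℝ) (hf : ContDiff ℝ ∞ f) (i : Fin 3) :
    partialDeriv i (a • f) = a • partialDeriv i f := by
  funext x
  unfold partialDeriv
  rw [fderiv_const_smul (hf.differentiable (by simp) x) a]
  rfl

lemma tendsto_eLpNorm_add {μ : Measure E3} {u v : ℕ → E3 → ℝ} {f g : E3 → ℝ}
    (hu : ∀ n, Continuous (u n)) (hv : ∀ n, Continuous (v n)) (hf : MemLp f 2 μ) (hg : MemLp g 2 μ)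
    (h1 : Tendsto (fun n => eLpNorm (u n - f) 2 μ) atTop (𝓝 0))
    (h2 : Tendsto (fun n => eLpNorm (v n - g) 2 μ) atTop (𝓝 0)) :
    Tendsto (fun n => eLpNorm (u n + v n - (f + g)) 2 μ) atTop (𝓝 0) := by
  have h0 := h1.add h2
  rw [add_zero] at h0
  refine tendsto_of_tendsto_of_tendsto_of_le_of_le tendsto_const_nhds h0 (fun _ => zero_le)
    fun n => ?_
  have e : u n + v n - (f + g) = (u n - f) + (v n - g) := by abel
  beta_reduce
  rw [e]
  exact eLpNorm_add_le ((hu n).aestronglyMeasurable.sub hf.1)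
    ((hv n).aestronglyMeasurable.sub hg.1) one_le_two

lemma tendsto_eLpNorm_smul {μ : Measure E3} {u : ℕ → E3 → ℝ} {f : E3 → ℝ} (a : ℝ)
    (h1 : Tendsto (fun n => eLpNorm (u n - f) 2 μ) atTop (𝓝 0)) :
    Tendsto (fun n => eLpNorm (a • u n - a • f) 2 μ) atTop (𝓝 0) := by
  have h0 := ENNReal.Tendsto.const_mul (a := ‖a‖ₑ) h1 (Or.inr enorm_ne_top)
  rw [mul_zero] at h0
  refine h0.congr fun n => ?_
  rw [← eLpNorm_const_smul, smul_sub]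

lemma MemH10.add {Ω : Set E3} {f g : E3 → ℝ} (hf : MemH10 Ω f) (hg : MemH10 Ω g) :
    MemH10 Ω (f + g) := by
  obtain ⟨hf3, df, hdf, φ, hφ, hφ1, hφ2⟩ := hf
  obtain ⟨hg3, dg, hdg, ψ, hψ, hψ1, hψ2⟩ := hg
  refine ⟨hf3.add hg3, fun i => df i + dg i, fun i => (hdf i).add (hdg i), fun n => φ n + ψ n,
    fun n => ⟨(hφ n).1.add (hψ n).1, (hφ n).2.1.add (hψ n).2.1,
      (tsupport_add (φ n) (ψ n)).trans (Set.union_subset (hφ n).2.2 (hψ n).2.2)⟩, ?_, fun i => ?_⟩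
  · exact tendsto_eLpNorm_add (fun n => (hφ n).1.continuous) (fun n => (hψ n).1.continuous)
      hf3 hg3 hφ1 hψ1
  · simp only [partialDeriv_add (hφ _).1 (hψ _).1]
    exact tendsto_eLpNorm_add (fun n => continuous_partialDeriv (hφ n).1 i)
      (fun n => continuous_partialDeriv (hψ n).1 i) (hdf i) (hdg i) (hφ2 i) (hψ2 i)

lemma MemH10.smul {Ω : Set E3} {f : E3 → ℝ} (a : ℝ) (hf : MemH10 Ω f) : MemH10 Ω (a • f) := by
  obtain ⟨hf3, df, hdf, φ, hφ, hφ1, hφ2⟩ := hf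
  refine ⟨hf3.const_smul a, fun i => a • df i, fun i => (hdf i).const_smul a, fun n => a • φ n,
    fun n => ⟨(hφ n).1.const_smul a, (hφ n).2.1.smul_left (f := fun _ => a),
      (tsupport_smul_subset_right (fun _ => a) (φ n)).trans (hφ n).2.2⟩, ?_, fun i => ?_⟩
  · exact tendsto_eLpNorm_smul a hφ1
  · simp only [partialDeriv_smul a (hφ _).1]
    exact tendsto_eLpNorm_smul a (hφ2 i)

lemma memH10_zero (Ω : Set E3) : MemH10 Ω 0 := by
  have hd : ∀ i, partialDeriv i (0 : E3 → ℝ) = 0 := fun i => by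
    funext x
    unfold partialDeriv
    rw [fderiv_zero]
    rfl
  refine ⟨MemLp.zero, fun _ => 0, fun _ => MemLp.zero, fun _ => 0,
    fun n => ⟨contDiff_const, HasCompactSupport.zero, ?_⟩, ?_, fun i => ?_⟩
  · rw [show tsupport (0 : E3 → ℝ) = ∅ from tsupport_eq_empty_iff.2 rfl]
    exact Set.empty_subset Ω
  · simp only [sub_zero, eLpNorm_zero]
    exact tendsto_const_nhds
  · simp only [hd, sub_zero, eLpNorm_zero]
    exact tendsto_const_nhds

end CrouzeixRaviart

open CrouzeixRaviart

/-! ### Meshes -/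

/-- A regular (conforming, no hanging nodes) finite tetrahedral mesh of `Ω`: a finite simplicial
complex whose simplices are tetrahedra and their faces and whose union is the closure of `Ω`.
Simplices are given by their sets of vertices. -/
structure TetMesh (Ω : Set E3) where
  complex : Geometry.SimplicialComplex ℝ E3
  finite : complex.faces.Finite
  pure : ∀ s ∈ complex.faces, ∃ K ∈ complex.faces, s ⊆ K ∧ K.card = 4
  space_eq : complex.space = closure Ω

namespace TetMesh

variable {Ω : Set E3} (G : TetMesh Ω)

/-- The mesh simplices with `m` vertices. -/
def simplices (m : ℕ) : Finset (Finset E3) := G.finite.toFinset.filter fun s => s.card = m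

/-- The tetrahedra of the mesh. -/
def tets : Finset (Finset E3) := G.simplices 4

open Classical in
/-- The mesh simplices with `m` vertices which do not lie on the boundary of `Ω`. -/
def innerSimplices (m : ℕ) : Finset (Finset E3) :=
  (G.simplices m).filter fun s => ¬ (convexHull ℝ (s : Set E3) ⊆ frontier Ω)

/-- The inner facets. -/
def innerFacets : Finset (Finset E3) := G.innerSimplices 3

/-- The inner edges. -/
def innerEdges : Finset (Finset E3) := G.innerSimplices 2

/-- The vertices of the mesh. -/
def vertices : Set E3 := G.complex.vertices

/-- The interior vertices of the mesh. -/
def innerVertices : Set E3 := G.vertices ∩ Ω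

/-- The nodal points of order `p` of the mesh. -/
def nodes (p : ℕ) : Set E3 := {N | ∃ K ∈ G.tets, ∃ α ∈ multiIndices p K, node p K α = N}

/-- The nodal points of order `p` which lie in `Ω`. -/
def innerNodes (p : ℕ) : Set E3 := G.nodes p ∩ Ω

/-! ### Piecewise polynomials given by nodal values

Functions on `Ω` are considered up to null sets, so that the skeleton of the mesh is negligible. -/

/-- The function which on the interior of each tetrahedron `K` is the polynomial of degree at most
`p` with the value `c K N` at each nodal point `N` of `K`, and which is `0` elsewhere. -/
def piecewiseFun (p : ℕ) (c : Finset E3 → E3 → ℝ) (x : E3) : ℝ :=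
  ∑ K ∈ G.tets, (interior (convexHull ℝ (K : Set E3))).indicator
    (fun y => ∑ α ∈ multiIndices p K, c K (node p K α) * shape p K α y) x

lemma measurable_piecewiseFun (p : ℕ) (c : Finset E3 → E3 → ℝ) :
    Measurable (G.piecewiseFun p c) := by
  unfold piecewiseFun
  refine Finset.measurable_fun_sum _ fun K _ => Measurable.indicator ?_ isOpen_interior.measurableSet
  exact (continuous_finsetSum _ fun α _ =>
    continuous_const.mul (continuous_shape p K α)).measurable

/-- The class of `piecewiseFun` modulo equality almost everywhere in `Ω`. -/
def piecewiseInterp (p : ℕ) (c : Finset E3 → E3 → ℝ) : E3 →ₘ[volume.restrict Ω] ℝ :=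
  AEEqFun.mk (G.piecewiseFun p c) (G.measurable_piecewiseFun p c).aestronglyMeasurable

/-! ### Conforming finite elements -/

/-- `f` is continuous on the closure of `Ω`, a polynomial of degree at most `p` on each tetrahedron
of the mesh, and belongs to `H₀¹(Ω)`. -/
def IsConforming (p : ℕ) (f : E3 → ℝ) : Prop :=
  ContinuousOn f (closure Ω) ∧
  (∀ K ∈ G.tets, ∃ P : MvPolynomial (Fin 3) ℝ, P.totalDegree ≤ p ∧
    ∀ x ∈ convexHull ℝ (K : Set E3), f x = MvPolynomial.eval (fun i => x i) P) ∧
  MemH10 Ω f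

lemma IsConforming.add {p : ℕ} {f g : E3 → ℝ} (hf : G.IsConforming p f)
    (hg : G.IsConforming p g) : G.IsConforming p (f + g) := by
  refine ⟨hf.1.add hg.1, fun K hK => ?_, hf.2.2.add hg.2.2⟩
  obtain ⟨P, hP, hfP⟩ := hf.2.1 K hK
  obtain ⟨Q, hQ, hgQ⟩ := hg.2.1 K hK
  refine ⟨P + Q, (MvPolynomial.totalDegree_add P Q).trans (max_le hP hQ), fun x hx => ?_⟩
  simp [hfP x hx, hgQ x hx]

lemma IsConforming.smul {p : ℕ} {f : E3 → ℝ} (a : ℝ) (hf : G.IsConforming p f) :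
    G.IsConforming p (a • f) := by
  refine ⟨hf.1.const_smul a, fun K hK => ?_, hf.2.2.smul a⟩
  obtain ⟨P, hP, hfP⟩ := hf.2.1 K hK
  refine ⟨a • P, (MvPolynomial.totalDegree_smul_le a P).trans hP, fun x hx => ?_⟩
  simp [hfP x hx]

lemma isConforming_zero (p : ℕ) : G.IsConforming p 0 :=
  ⟨continuousOn_const, fun K _ => ⟨0, by simp, by simp⟩, memH10_zero Ω⟩

/-- The conforming finite element space of order `p`. -/
def conformingSpace (p : ℕ) : Submodule ℝ (E3 →ₘ[volume.restrict Ω] ℝ) where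
  carrier := {u | ∃ f : E3 → ℝ, G.IsConforming p f ∧ u =ᵐ[volume.restrict Ω] f}
  zero_mem' := ⟨0, G.isConforming_zero p, AEEqFun.coeFn_zero⟩
  add_mem' := by
    rintro u v ⟨f, hf, hu⟩ ⟨g, hg, hv⟩
    exact ⟨f + g, hf.add G hg, (AEEqFun.coeFn_add u v).trans (hu.add hv)⟩
  smul_mem' := by
    rintro a u ⟨f, hf, hu⟩
    exact ⟨a • f, hf.smul G a, (AEEqFun.coeFn_smul a u).trans (hu.const_smul a)⟩

open Classical in
/-- The Lagrange basis function of the nodal point `N`: continuous and piecewise polynomial of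
degree at most `p`, equal to `1` at `N` and to `0` at all other nodal points of the mesh. -/
def lagrangeBasis (p : ℕ) (N : E3) : E3 →ₘ[volume.restrict Ω] ℝ :=
  G.piecewiseInterp p fun _ N' => if N' = N then 1 else 0

/-- The span of the Lagrange basis functions of the inner nodal points in the relative interior of
the simplex with vertex set `s`. -/
def conformingPart (p : ℕ) (s : Finset E3) : Submodule ℝ (E3 →ₘ[volume.restrict Ω] ℝ) :=
  Submodule.span ℝ (G.lagrangeBasis p ''
    (intrinsicInterior ℝ (convexHull ℝ (s : Set E3)) ∩ G.innerNodes p))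

/-- The conforming finite element space without the vertex basis functions. -/
def conformingSpaceWithoutVertices (p : ℕ) : Submodule ℝ (E3 →ₘ[volume.restrict Ω] ℝ) :=
  (⨆ E ∈ G.innerEdges, G.conformingPart p E) ⊔ (⨆ T ∈ G.innerFacets, G.conformingPart p T) ⊔
    (⨆ K ∈ G.tets, G.conformingPart p K)

/-! ### Non-conforming functions supported on one tetrahedron -/

/-- `N` lies on the facet of `K` with the three vertices `t.1`, `t.2.1`, `t.2.2`. The affine pullback
`(x₁, x₂) ↦ t.1 + x₁ (t.2.1 - t.1) + x₂ (t.2.2 - t.1)` maps the reference triangle to this facet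
and the point `(bary K t.2.1 N, bary K t.2.2 N)` to `N`. -/
def IsFacetFrame (K : Finset E3) (N : E3) (t : E3 × E3 × E3) : Prop :=
  t.1 ∈ K ∧ t.2.1 ∈ K ∧ t.2.2 ∈ K ∧ t.1 ≠ t.2.1 ∧ t.1 ≠ t.2.2 ∧ t.2.1 ≠ t.2.2 ∧
    N ∈ convexHull ℝ ({t.1, t.2.1, t.2.2} : Set E3)

open Classical in
/-- The value of the symmetric function at the nodal point `N` of `K`: the lifted polynomial
`b_{p,k}^sym` if `N` lies on a facet of `K` (by total symmetry, the facet and the pullback do not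
matter), and `0` otherwise. -/
def symValue (p k : ℕ) (K : Finset E3) (N : E3) : ℝ :=
  if h : ∃ t, IsFacetFrame K N t then
    bSym p k (bary K h.choose.2.1 N) (bary K h.choose.2.2 N)
  else 0

open Classical in
/-- The tetrahedron-supported basis function `B_{p,k}^{K,nc}`. -/
def symBasis (p k : ℕ) (K : Finset E3) : E3 →ₘ[volume.restrict Ω] ℝ :=
  G.piecewiseInterp p fun K' N => if K' = K then symValue p k K N else 0

/-- The symmetric non-conforming space. -/
def symSpace (p : ℕ) : Submodule ℝ (E3 →ₘ[volume.restrict Ω] ℝ) :=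
  ⨆ K ∈ G.tets, Submodule.span ℝ ((fun k => G.symBasis p k K) '' {k | k < dTriv p})

/-! ### Non-conforming functions supported on two adjacent tetrahedra -/

open Classical in
/-- The value on the side of `K` of the reflection-type function of the facet `T ⊆ K` at the nodal
point `N` of `K`: the lifted polynomial `b_{p,k}^refl` if `N` lies on a facet of `K` other than `T`,
where the origin is mapped to the vertex of `K` opposite to `T` (by mirror symmetry, the remaining
choices do not matter), and `0` otherwise. -/
def reflValue (p k : ℕ) (T K : Finset E3) (N : E3) : ℝ :=
  if h : ∃ t, IsFacetFrame K N t ∧ t.1 ∉ T then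
    bRefl p k (bary K h.choose.2.1 N) (bary K h.choose.2.2 N)
  else 0

open Classical in
/-- The facet-oriented basis function `B_{p,k}^{T,nc}`, supported on the tetrahedra which have `T`
as a facet. -/
def reflBasis (p k : ℕ) (T : Finset E3) : E3 →ₘ[volume.restrict Ω] ℝ :=
  G.piecewiseInterp p fun K N => if T ⊆ K then reflValue p k T K N else 0

/-- The reflection-type non-conforming space. -/
def reflSpace (p : ℕ) : Submodule ℝ (E3 →ₘ[volume.restrict Ω] ℝ) :=
  ⨆ T ∈ G.innerFacets, Submodule.span ℝ ((fun k => G.reflBasis p k T) '' {k | k < dRefl p})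

/-- The subspace of the reflection-type space spanned by the functions with index at most `k`. -/
def reflSpaceUpTo (p k : ℕ) : Submodule ℝ (E3 →ₘ[volume.restrict Ω] ℝ) :=
  ⨆ T ∈ G.innerFacets, Submodule.span ℝ ((fun m => G.reflBasis p m T) '' {m | m ≤ k})

end TetMesh

end

/-! Put q(t) = P_p^(0,1)(1 - 2t), which is `edgePoly`. On a triangle with barycentric coordinates
l0, l1, l2 the polynomial b_{p,0} equals q(l0), so the first reflection polynomial is (2 q(l0) -
q(l1) - q(l2)) / 3. Fix a tetrahedron K containing V and let S be the sum of q over all four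
coordinates of a nodal point. The function of the facet opposite v takes there the value q(l_v) -
S/3 + q(0)/3 if the node lies on a facet of K through v, and 0 otherwise.

Summing over the three v different from V, S cancels: if all three terms are present, the total is
q(0) - q(l_V), which vanishes for l_V = 0. In the relative interior of a facet through V exactly one
term is missing, and the total is symmetric in the other nonzero coordinates. In both cases it
depends only on the nodal point and not on K (`sum_reflValue_erase`). So the nodal values match
across facets and the sum is continuous. It vanishes off the open star of V, which lies in Ω because
Ω is the interior of its closure (`mem_of_bary_pos`). At V the value is q(0) - q(1) = 1 - (-1)^p
(p+1), nonzero since p ≥ 1, and c is its inverse.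

Membership in H₀¹ follows because the glued function is Lipschitz (`lipschitzWith_of_finite_cover`)
and a Lipschitz function vanishing outside a bounded Ω lies in H₀¹ (`memH10_of_lipschitzWith`). The
difference from the Lagrange function of V has nonzero nodal values only inside edges and facets
through V, so it needs no vertex functions. The sum is nonzero because it is continuous with value 1
at V; this rules out directness. -/

noncomputable section

namespace CrouzeixRaviart

/-! ### The Jacobi polynomial `P_p^(0,1)` and the first orthogonal polynomial of reflection type -/

/-- The polynomial `P_p^(0,1)(1 - 2t)`. -/
def edgePoly (p : ℕ) (t : ℝ) : ℝ := jacobi p 0 1 (1 - 2 * t)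

/-- For k = 0 the Legendre factor is constant, so only the barycentric coordinate of the origin
survives. -/
lemma bPoly_zero (p : ℕ) (x₁ x₂ : ℝ) : bPoly p 0 x₁ x₂ = edgePoly p (1 - x₁ - x₂) := by
  have h0 : ∀ x, jacobi 0 0 0 x = 1 := fun x => by simp [jacobi, poch]
  unfold bPoly edgePoly
  rw [h0, Nat.sub_zero, pow_zero, one_mul, mul_one, Nat.cast_zero, mul_zero, zero_add]
  congr 1
  ring

/-- The two rotations permute the barycentric coordinates cyclically, so each of the three summands
sees a single coordinate. -/
lemma bRefl_zero (p : ℕ) (x₁ x₂ : ℝ) :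
    bRefl p 0 x₁ x₂ =
      (2 * edgePoly p (1 - x₁ - x₂) - edgePoly p x₁ - edgePoly p x₂) / 3 := by
  unfold bRefl
  simp only [mul_zero, bPoly_zero]
  rw [show 1 - x₂ - (1 - x₁ - x₂) = x₁ by ring, show 1 - (1 - x₁ - x₂) - x₁ = x₂ by ring]
  ring

lemma poch_one (n : ℕ) : poch 1 n = n.factorial := ascPochhammer_eval_one ℝ n

lemma poch_neg_cast (p k : ℕ) : poch (-(p : ℝ)) k = (-1) ^ k * (p.choose k * k.factorial) := by
  unfold poch
  rw [ascPochhammer_eval_neg_eq_descPochhammer, descPochhammer_eval_eq_descFactorial,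
    Nat.descFactorial_eq_factorial_mul_choose]
  push_cast
  ring

lemma poch_cast_add_two (p k : ℕ) :
    poch ((p : ℝ) + 2) k = (p + 1 + k).choose (p + 1) * k.factorial := by
  have h := ascPochhammer_nat_eq_natCast_ascFactorial ℝ (p + 2) k
  unfold poch
  have e : ((p + 2 : ℕ) : ℝ) = (p : ℝ) + 2 := by push_cast; ring
  rw [← e, h, Nat.ascFactorial_eq_factorial_mul_choose, Nat.choose_symm_of_eq_add (by omega : p + 1 + k = k + (p + 1))]
  push_cast
  ring

/-- Up to sign this is the p-th forward difference of x ↦ C(x, p+1) at x = p+1, and each difference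
lowers the lower index by one, leaving C(p+1, 1). -/
lemma sum_choose_mul_choose (p : ℕ) :
    ∑ k ∈ Finset.range (p + 1), (-1 : ℤ) ^ k * p.choose k * (p + 1 + k).choose (p + 1) =
      (-1) ^ p * (p + 1) := by
  have h := fwdDiff_iter_eq_sum_shift (1 : ℕ) (fun x => (x.choose (p + 1) : ℤ)) p (p + 1)
  have h1 : (fwdDiff 1)^[p] (fun x : ℕ => (x.choose (p + 1) : ℤ)) = fun x => (x.choose 1 : ℤ) :=
    fwdDiff_iter_choose 1 p
  rw [h1] at h
  simp only [Nat.choose_one_right, smul_eq_mul, mul_one] at h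
  have h2 : (-1 : ℤ) ^ p * ((p + 1 : ℕ) : ℤ) = (-1) ^ p * (p + 1) := by push_cast; rfl
  rw [← h2, h, Finset.mul_sum]
  refine Finset.sum_congr rfl fun k hk => ?_
  have hk' : k ≤ p := Nat.lt_succ_iff.1 (Finset.mem_range.1 hk)
  have e : (-1 : ℤ) ^ k = (-1) ^ p * (-1) ^ (p - k) := by
    obtain ⟨m, rfl⟩ := Nat.exists_eq_add_of_le hk'
    rw [Nat.add_sub_cancel_left, pow_add, mul_assoc, ← mul_pow]
    simp
  rw [e]
  ring

lemma edgePoly_zero (p : ℕ) : edgePoly p 0 = 1 := by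
  unfold edgePoly jacobi
  -- At t = 0 the series variable (1 - x)/2 is 0, so only the term k = 0 remains.
  rw [Finset.sum_range_succ']
  have h1 : poch (0 + 1) p = p.factorial := by rw [zero_add, poch_one]
  rw [h1]
  simp [poch, Nat.factorial_ne_zero]

lemma edgePoly_one (p : ℕ) : edgePoly p 1 = (-1) ^ p * (p + 1) := by
  unfold edgePoly jacobi
  have h1 : ∀ n, poch (0 + 1) n = n.factorial := fun n => by rw [zero_add, poch_one]
  have h2 := congrArg (Int.cast : ℤ → ℝ) (sum_choose_mul_choose p)
  push_cast at h2
  rw [h1, div_self (by exact_mod_cast Nat.factorial_ne_zero p), one_mul, ← h2]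
  refine Finset.sum_congr rfl fun k _ => ?_
  have hf : (k.factorial : ℝ) ≠ 0 := by exact_mod_cast Nat.factorial_ne_zero k
  rw [h1, poch_neg_cast p k, show (p : ℝ) + 0 + 1 + 1 = p + 2 by ring, poch_cast_add_two]
  rw [show ((1 : ℝ) - (1 - 2 * 1)) / 2 = 1 by norm_num, one_pow]
  field_simp

/-- The absolute values are 1 and p + 1. This makes the vertex value of the reflection sum
invertible. -/
lemma edgePoly_zero_ne_one {p : ℕ} (hp : 1 ≤ p) : edgePoly p 0 ≠ edgePoly p 1 := by
  rw [edgePoly_zero, edgePoly_one]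
  intro h
  have h1 := congrArg abs h
  rw [abs_mul, abs_pow, abs_neg, abs_one, one_pow, one_mul, abs_of_nonneg (by positivity)] at h1
  have : (1 : ℝ) ≤ p := by exact_mod_cast hp
  linarith

end CrouzeixRaviart
end

noncomputable section

namespace CrouzeixRaviart

/-! ### Lipschitz functions that vanish outside `Ω` belong to `H₀¹(Ω)` -/

/-- Vitali's theorem: a uniform bound on a finite measure space gives uniform integrability, since
the sets where |u n| exceeds C + 1 are empty. -/
lemma tendsto_eLpNorm_sub_of_bounded {μ : Measure E3} [IsFiniteMeasure μ] {u : ℕ → E3 → ℝ}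
    {f : E3 → ℝ} (C : ℝ) (hu : ∀ n, AEStronglyMeasurable (u n) μ) (hC : ∀ n x, ‖u n x‖ ≤ C)
    (hf : AEStronglyMeasurable f μ)
    (h : ∀ᵐ x ∂μ, Tendsto (fun n => u n x) atTop (𝓝 (f x))) :
    Tendsto (fun n => eLpNorm (u n - f) 2 μ) atTop (𝓝 0) := by
  refine tendsto_Lp_finite_of_tendsto_ae one_le_two (by simp) hu ?_ ?_ h
  · refine MemLp.of_bound hf C ?_
    filter_upwards [h] with x hx
    exact le_of_tendsto hx.norm (Eventually.of_forall fun n => hC n x)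
  · refine unifIntegrable_of one_le_two (by simp) hu fun ε hε => ⟨Real.toNNReal (C + 1), fun n => ?_⟩
    have : {x | Real.toNNReal (C + 1) ≤ ‖u n x‖₊} = ∅ := by
      refine Set.eq_empty_of_forall_notMem fun x hx => ?_
      have h1 : (Real.toNNReal (C + 1) : ℝ) ≤ ‖u n x‖ := by exact_mod_cast hx
      have h2 := Real.le_coe_toNNReal (C + 1)
      linarith [hC n x]
    rw [this]
    simp

/-- A smooth function which vanishes on `[-1, 1]` and is the identity outside `[-2, 2]`. -/
def softThreshold (s : ℝ) : ℝ := s * Real.smoothTransition (s ^ 2 - 1)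

lemma contDiff_softThreshold : ContDiff ℝ ∞ softThreshold :=
  contDiff_id.mul (Real.smoothTransition.contDiff.comp ((contDiff_id.pow 2).sub contDiff_const))

lemma softThreshold_of_abs_le {s : ℝ} (hs : |s| ≤ 1) : softThreshold s = 0 := by
  unfold softThreshold
  rw [Real.smoothTransition.zero_of_nonpos, mul_zero]
  have := (sq_le_one_iff_abs_le_one s).2 hs
  linarith

lemma softThreshold_of_le_abs {s : ℝ} (hs : 2 ≤ |s|) : softThreshold s = s := by
  unfold softThreshold
  rw [Real.smoothTransition.one_of_one_le, mul_one]
  rw [← sq_abs]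
  nlinarith

lemma abs_softThreshold_le (s : ℝ) : |softThreshold s| ≤ |s| := by
  unfold softThreshold
  rw [abs_mul, abs_of_nonneg (Real.smoothTransition.nonneg _)]
  exact mul_le_of_le_one_right (abs_nonneg s) (Real.smoothTransition.le_one _)

lemma abs_softThreshold_sub_le (s : ℝ) : |softThreshold s - s| ≤ 2 := by
  rcases le_total 2 |s| with h | h
  · rw [softThreshold_of_le_abs h]; simp
  · unfold softThreshold
    rw [show s * Real.smoothTransition (s ^ 2 - 1) - s
      = -(s * (1 - Real.smoothTransition (s ^ 2 - 1))) by ring, abs_neg, abs_mul,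
      abs_of_nonneg (sub_nonneg.2 (Real.smoothTransition.le_one _))]
    have := Real.smoothTransition.nonneg (s ^ 2 - 1)
    nlinarith [abs_nonneg s]

lemma deriv_softThreshold_of_abs_lt {s : ℝ} (hs : |s| < 1) : deriv softThreshold s = 0 := by
  have : softThreshold =ᶠ[𝓝 s] fun _ => 0 := by
    filter_upwards [(isOpen_lt continuous_abs continuous_const).mem_nhds hs] with t ht
    exact softThreshold_of_abs_le (le_of_lt ht)
  rw [this.deriv_eq, deriv_const]

lemma deriv_softThreshold_of_lt_abs {s : ℝ} (hs : 2 < |s|) : deriv softThreshold s = 1 := by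
  have : softThreshold =ᶠ[𝓝 s] fun t => t := by
    filter_upwards [(isOpen_lt continuous_const continuous_abs).mem_nhds hs] with t ht
    exact softThreshold_of_le_abs (le_of_lt ht)
  rw [this.deriv_eq, deriv_id'']

lemma exists_abs_deriv_softThreshold_le : ∃ M : ℝ, ∀ s, |deriv softThreshold s| ≤ M := by
  have hc : Continuous (deriv softThreshold) := contDiff_softThreshold.continuous_deriv (by simp)
  obtain ⟨M, hM⟩ := (isCompact_Icc (a := (-2 : ℝ)) (b := 2)).exists_bound_of_continuousOn
    hc.continuousOn
  refine ⟨max M 1, fun s => ?_⟩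
  by_cases hs : 2 < |s|
  · rw [deriv_softThreshold_of_lt_abs hs]; simp
  · exact (hM s (abs_le.1 (not_lt.1 hs))).trans (le_max_left _ _)

section Mollifier

variable {f : E3 → ℝ} {L : NNReal} (φ : ContDiffBump (0 : E3))

/-- The mollification of `f` by the normed bump function `φ`. -/
def mollify (f : E3 → ℝ) : E3 → ℝ :=
  convolution (φ.normed volume) f (ContinuousLinearMap.lsmul ℝ ℝ) volume

lemma contDiff_mollify (hf : LipschitzWith L f) : ContDiff ℝ ∞ (mollify φ f) :=
  φ.hasCompactSupport_normed.contDiff_convolution_left _ φ.contDiff_normed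
    hf.continuous.locallyIntegrable

lemma dist_mollify_le (hf : LipschitzWith L f) (x : E3) :
    |mollify φ f x - f x| ≤ L * φ.rOut := by
  rw [← Real.dist_eq]
  refine ContDiffBump.dist_normed_convolution_le hf.continuous.aestronglyMeasurable
    fun y hy => ?_
  exact (hf.dist_le_mul y x).trans (mul_le_mul_of_nonneg_left (le_of_lt hy) L.2)

/-- The derivative is put on f, which is differentiable almost everywhere by Rademacher's theorem.
This form gives both the bound by L and the almost everywhere convergence of the gradients. -/
lemma hasFDerivAt_mollify (hf : LipschitzWith L f) (x : E3) :
    HasFDerivAt (mollify φ f)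
      (convolution (φ.normed volume) (fderiv ℝ f) (ContinuousLinearMap.lsmul ℝ ℝ) volume x) x := by
  have hmeas : AEStronglyMeasurable (fun t => φ.normed volume t • fderiv ℝ f (x - t)) volume :=
    (φ.continuous_normed.measurable.smul
      ((measurable_fderiv ℝ f).comp (measurable_const.sub measurable_id))).aestronglyMeasurable
  refine (hasFDerivAt_integral_of_dominated_loc_of_lip (s := Set.univ)
    (F := fun x t => φ.normed volume t • f (x - t))
    (F' := fun t => φ.normed volume t • fderiv ℝ f (x - t))
    (bound := fun t => φ.normed volume t * L) univ_mem ?_ ?_ hmeas ?_ ?_ ?_).2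
  · exact Eventually.of_forall fun y => (φ.continuous_normed.smul
      (hf.continuous.comp (continuous_const.sub continuous_id))).aestronglyMeasurable
  · exact (φ.continuous_normed.smul
      (hf.continuous.comp (continuous_const.sub continuous_id))).integrable_of_hasCompactSupport
        φ.hasCompactSupport_normed.smul_right
  · refine Eventually.of_forall fun t => LipschitzWith.lipschitzOnWith ?_
    refine LipschitzWith.of_dist_le_mul fun y z => ?_
    rw [dist_smul₀, Real.norm_eq_abs, Real.coe_nnabs, abs_mul,
      abs_of_nonneg L.coe_nonneg, mul_assoc]
    refine mul_le_mul_of_nonneg_left ?_ (abs_nonneg _)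
    simpa using hf.dist_le_mul (y - t) (z - t)
  · exact φ.integrable_normed.mul_const _
  · have hd := hf.ae_differentiableAt (μ := volume)
    have := (Measure.measurePreserving_sub_left volume x).quasiMeasurePreserving.ae hd
    filter_upwards [this] with t ht
    exact ((hasFDerivAt_comp_sub t).2 ht.hasFDerivAt).const_smul (φ.normed volume t)

lemma norm_fderiv_mollify_le (hf : LipschitzWith L f) (x : E3) :
    ‖fderiv ℝ (mollify φ f) x‖ ≤ L := by
  rw [(hasFDerivAt_mollify φ hf x).fderiv]
  refine (norm_integral_le_of_norm_le (g := fun t => φ.normed volume t * L)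
    (φ.integrable_normed.mul_const _) (Eventually.of_forall fun t => ?_)).trans ?_
  · rw [ContinuousLinearMap.lsmul_apply, norm_smul, Real.norm_eq_abs,
      abs_of_nonneg (φ.nonneg_normed t)]
    exact mul_le_mul_of_nonneg_left (norm_fderiv_le_of_lipschitz ℝ hf) (φ.nonneg_normed t)
  · rw [integral_mul_const, φ.integral_normed, one_mul]

lemma locallyIntegrable_fderiv (hf : LipschitzWith L f) :
    LocallyIntegrable (fderiv ℝ f) (volume : Measure E3) := by
  refine (memLp_top_of_bound (measurable_fderiv ℝ f).aestronglyMeasurable L ?_).locallyIntegrable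
    le_top
  exact Eventually.of_forall fun x => norm_fderiv_le_of_lipschitz ℝ hf

end Mollifier

/-- Mollification F n alone may leak outside Ω. Composing with the soft threshold at height ε n
removes the region where f is small, and what remains is supported in a closed subset of Ω, at the
cost of an error at most 2 ε n. -/
theorem memH10_of_lipschitzWith {Ω : Set E3} (hb : Bornology.IsBounded Ω) {f : E3 → ℝ}
    {L : NNReal} (hf : LipschitzWith L f) (hf0 : ∀ x, x ∉ Ω → f x = 0) : MemH10 Ω f := by
  have : IsFiniteMeasure (volume.restrict Ω) :=
    ⟨by rw [Measure.restrict_apply_univ]; exact hb.measure_lt_top⟩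
  obtain ⟨C, hC⟩ : ∃ C, ∀ x, |f x| ≤ C := by
    obtain ⟨C, hC⟩ := (hf.isBounded_image hb).exists_norm_le
    refine ⟨max C 0, fun x => ?_⟩
    by_cases hx : x ∈ Ω
    · exact (hC _ (Set.mem_image_of_mem f hx)).trans (le_max_left _ _)
    · rw [hf0 x hx, abs_zero]; exact le_max_right _ _
  obtain ⟨M, hM⟩ := exists_abs_deriv_softThreshold_le
  have hM0 : 0 ≤ M := (abs_nonneg _).trans (hM 0)
  set ε : ℕ → ℝ := fun n => 1 / ((n : ℝ) + 1) with hε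
  have hεpos : ∀ n, 0 < ε n := fun n => Nat.one_div_pos_of_nat
  have hεlim : Tendsto ε atTop (𝓝 0) := tendsto_one_div_add_atTop_nhds_zero_nat
  have hεle : ∀ n, ε n ≤ 1 := fun n => by
    rw [hε]; simp only
    rw [div_le_one (by positivity)]
    linarith [Nat.cast_nonneg (α := ℝ) n]
  have hL : (0 : ℝ) ≤ L := L.2
  -- With outer radius 2 r n the mollification error is at most L · 2 r n ≤ ε n / 2; L + 1 avoids
  -- dividing by zero when L = 0.
  set r : ℕ → ℝ := fun n => ε n / (4 * (L + 1)) with hr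
  have hrpos : ∀ n, 0 < r n := fun n => div_pos (hεpos n) (by positivity)
  let φ : ℕ → ContDiffBump (0 : E3) := fun n => ⟨r n, 2 * r n, hrpos n, by linarith [hrpos n]⟩
  have hφr : ∀ n, (φ n).rOut = 2 * r n := fun n => rfl
  set F : ℕ → E3 → ℝ := fun n => mollify (φ n) f with hF
  have hFs : ∀ n, ContDiff ℝ ∞ (F n) := fun n => contDiff_mollify _ hf
  have hFd : ∀ n x, |F n x - f x| ≤ ε n / 2 := fun n x => by
    refine (dist_mollify_le (φ n) hf x).trans ?_
    rw [hφr, hr]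
    simp only
    rw [show (L : ℝ) * (2 * (ε n / (4 * (L + 1)))) = ε n / 2 * (L / (L + 1)) by field_simp; ring]
    exact mul_le_of_le_one_right (by linarith [hεpos n])
      ((div_le_one (by positivity)).2 (by linarith))
  have hFlim : ∀ x, Tendsto (fun n => F n x) atTop (𝓝 (f x)) := fun x => by
    rw [tendsto_iff_dist_tendsto_zero]
    refine squeeze_zero (fun n => dist_nonneg) (fun n => ?_) (by simpa using hεlim.div_const 2)
    exact hFd n x
  set u : ℕ → E3 → ℝ := fun n x => ε n * softThreshold (F n x / ε n) with hu
  have hus : ∀ n, ContDiff ℝ ∞ (u n) := fun n =>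
    contDiff_const.mul (contDiff_softThreshold.comp ((hFs n).div_const _))
  have hsupp : ∀ n, Function.support (u n) ⊆ {x | ε n / 2 ≤ |f x|} := by
    intro n x hx
    by_contra h
    simp only [Set.mem_ofPred_eq, not_le] at h
    apply hx
    have h1 : |F n x| ≤ ε n := by
      have := abs_add_le (F n x - f x) (f x)
      rw [sub_add_cancel] at this
      linarith [hFd n x]
    rw [hu]
    simp only
    rw [softThreshold_of_abs_le, mul_zero]
    rw [abs_div, abs_of_pos (hεpos n)]
    exact (div_le_one (hεpos n)).2 h1
  have hts : ∀ n, tsupport (u n) ⊆ {x | ε n / 2 ≤ |f x|} := fun n =>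
    closure_minimal (hsupp n) (isClosed_le continuous_const hf.continuous.abs)
  have hsub : ∀ n, {x | ε n / 2 ≤ |f x|} ⊆ Ω := by
    intro n x hx
    by_contra h
    rw [Set.mem_ofPred_eq, hf0 x h, abs_zero] at hx
    linarith [hεpos n]
  have hpd : ∀ n i x, partialDeriv i (u n) x =
      deriv softThreshold (F n x / ε n) * fderiv ℝ (F n) x (EuclideanSpace.single i 1) := by
    intro n i x
    have h1 : HasFDerivAt (F n) (fderiv ℝ (F n) x) x :=
      ((hFs n).differentiable (by simp) x).hasFDerivAt
    have h2 : HasDerivAt softThreshold (deriv softThreshold (F n x / ε n)) (F n x / ε n) :=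
      (contDiff_softThreshold.differentiable (by simp) _).hasDerivAt
    have h3 : HasFDerivAt (fun y => F n y / ε n) ((ε n)⁻¹ • fderiv ℝ (F n) x) x := by
      simpa only [div_eq_inv_mul] using h1.const_mul (ε n)⁻¹
    have h4 : HasFDerivAt (fun y => softThreshold (F n y / ε n))
        (deriv softThreshold (F n x / ε n) • (ε n)⁻¹ • fderiv ℝ (F n) x) x :=
      HasDerivAt.comp_hasFDerivAt (f := fun y => F n y / ε n) x h2 h3
    have h5 : HasFDerivAt (u n)
        (ε n • deriv softThreshold (F n x / ε n) • (ε n)⁻¹ • fderiv ℝ (F n) x) x :=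
      h4.const_mul (ε n)
    unfold partialDeriv
    rw [h5.fderiv]
    simp only [smul_apply, smul_eq_mul]
    have := (hεpos n).ne'
    field_simp
  have hsingle : ∀ i : Fin 3, ‖(EuclideanSpace.single i 1 : E3)‖ = 1 := fun i => by simp
  -- The limit gradient is cut off on the zero set of f, where the approximants have zero gradient.
  -- This makes it unnecessary to know that the gradient of f vanishes almost everywhere there.
  set g : Fin 3 → E3 → ℝ := fun i => {x | f x ≠ 0}.indicator (partialDeriv i f) with hg
  have hpm : ∀ i, Measurable (partialDeriv i f) := fun i => measurable_fderiv_apply_const ℝ f _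
  have hgm : ∀ i, Measurable (g i) := fun i =>
    (hpm i).indicator (isOpen_ne_fun hf.continuous continuous_const).measurableSet
  refine ⟨MemLp.of_bound hf.continuous.aestronglyMeasurable C (Eventually.of_forall hC), g,
    fun i => MemLp.of_bound (hgm i).aestronglyMeasurable L (Eventually.of_forall fun x => ?_), u,
    fun n => ⟨hus n, ?_, (hts n).trans (hsub n)⟩, ?_, fun i => ?_⟩
  · refine (norm_indicator_le_norm_self _ _).trans ?_
    refine ((fderiv ℝ f x).le_opNorm _).trans ?_
    rw [hsingle, mul_one]
    exact norm_fderiv_le_of_lipschitz ℝ hf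
  · exact Metric.isCompact_of_isClosed_isBounded (isClosed_tsupport _)
      (hb.subset ((hts n).trans (hsub n)))
  · refine tendsto_eLpNorm_sub_of_bounded (C + 1) (fun n => (hus n).continuous.aestronglyMeasurable)
      (fun n x => ?_) hf.continuous.aestronglyMeasurable (Eventually.of_forall fun x => ?_)
    · have h1 : |u n x| ≤ |F n x| := by
        rw [hu]
        simp only
        rw [abs_mul, abs_of_pos (hεpos n)]
        refine (mul_le_mul_of_nonneg_left (abs_softThreshold_le _) (hεpos n).le).trans ?_
        rw [abs_div, abs_of_pos (hεpos n), mul_div_cancel₀ _ (hεpos n).ne']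
      have := abs_add_le (F n x - f x) (f x)
      rw [sub_add_cancel] at this
      rw [Real.norm_eq_abs]
      linarith [hFd n x, hC x, hεle n]
    · have h1 : Tendsto (fun n => u n x - F n x) atTop (𝓝 0) := by
        refine squeeze_zero_norm (fun n => ?_) (by simpa using hεlim.mul_const 2)
        rw [hu]
        simp only
        have : F n x = ε n * (F n x / ε n) := by rw [mul_div_cancel₀ _ (hεpos n).ne']
        nth_rw 2 [this]
        rw [← mul_sub, Real.norm_eq_abs, abs_mul, abs_of_pos (hεpos n)]
        exact mul_le_mul_of_nonneg_left (abs_softThreshold_sub_le _) (hεpos n).le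
      simpa using h1.add (hFlim x)
  · refine tendsto_eLpNorm_sub_of_bounded (M * L)
      (fun n => (continuous_partialDeriv (hus n) i).aestronglyMeasurable)
      (fun n x => ?_) (hgm i).aestronglyMeasurable ?_
    · rw [hpd, norm_mul]
      refine mul_le_mul (hM _) ?_ (norm_nonneg _) hM0
      refine ((fderiv ℝ (F n) x).le_opNorm _).trans ?_
      rw [hsingle, mul_one]
      exact norm_fderiv_mollify_le _ hf x
    -- Lebesgue differentiation for the mollified gradients; K = 2 is the fixed ratio of outer to
    -- inner radius.
    · have hae := ContDiffBump.ae_convolution_tendsto_right_of_locallyIntegrable (K := 2)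
        (φ := φ) (l := atTop)
        (by
          have : Tendsto (fun n => 2 * (ε n / (4 * ((L : ℝ) + 1)))) atTop (𝓝 0) := by
            simpa using (hεlim.div_const (4 * ((L : ℝ) + 1))).const_mul 2
          exact this) (Eventually.of_forall fun n => le_rfl)
        (locallyIntegrable_fderiv hf)
      refine ae_restrict_of_ae ?_
      filter_upwards [hae] with x hx
      simp only [hpd]
      by_cases hfx : f x = 0
      · rw [hg]
        simp only
        rw [Set.indicator_of_notMem (by simpa using hfx)]
        refine tendsto_const_nhds.congr fun n => ?_
        rw [deriv_softThreshold_of_abs_lt, zero_mul]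
        rw [abs_div, abs_of_pos (hεpos n), div_lt_one (hεpos n)]
        have := hFd n x
        rw [hfx, sub_zero] at this
        linarith [hεpos n]
      · rw [hg]
        simp only
        rw [Set.indicator_of_mem (by simpa using hfx)]
        have h1 : Tendsto (fun n => fderiv ℝ (F n) x (EuclideanSpace.single i 1)) atTop
            (𝓝 (partialDeriv i f x)) := by
          have : Tendsto (fun n => fderiv ℝ (F n) x) atTop (𝓝 (fderiv ℝ f x)) :=
            hx.congr fun n => ((hasFDerivAt_mollify (φ n) hf x).fderiv).symm
          exact ((ContinuousLinearMap.apply ℝ ℝ (EuclideanSpace.single i 1 : E3)).continuous.tendsto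
            _).comp this
        refine h1.congr' ?_
        have h2 : ∀ᶠ n in atTop, ε n * 2 < |F n x| :=
          Tendsto.eventually_lt (by simpa using hεlim.mul_const 2) (hFlim x).abs (abs_pos.2 hfx)
        filter_upwards [h2] with n hn
        rw [deriv_softThreshold_of_lt_abs, one_mul]
        rw [abs_div, abs_of_pos (hεpos n), lt_div_iff₀ (hεpos n)]
        linarith

end CrouzeixRaviart
end

noncomputable section

namespace CrouzeixRaviart

/-! ### Barycentric coordinates -/

/-- `K` is the vertex set of a nondegenerate tetrahedron. -/
def IsTet (K : Finset E3) : Prop :=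
  AffineIndependent ℝ (fun i : K => (i : E3)) ∧
    affineSpan ℝ (Set.range (fun i : K => (i : E3))) = ⊤

lemma bary_of_notMem {K : Finset E3} {v : E3} (hv : v ∉ K) (x : E3) : bary K v x = 0 := by
  unfold bary
  rw [dif_neg fun h => hv h.2]

namespace IsTet

variable {K : Finset E3} (hK : IsTet K)

/-- The vertices of a tetrahedron as an affine basis. -/
def basis : AffineBasis K ℝ E3 := AffineBasis.mk (fun i : K => (i : E3)) hK.1 hK.2

lemma basis_apply (i : K) : hK.basis i = i := rfl

lemma range_basis : Set.range hK.basis = (K : Set E3) := by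
  ext x
  simp [basis_apply]

lemma bary_eq {v : E3} (hv : v ∈ K) (x : E3) : bary K v x = hK.basis.coord ⟨v, hv⟩ x := by
  unfold bary
  rw [dif_pos ⟨hK, hv⟩]
  rfl

include hK in
lemma sum_bary (x : E3) : ∑ v ∈ K, bary K v x = 1 := by
  rw [← hK.basis.sum_coord_apply_eq_one x, ← Finset.sum_attach]
  exact Finset.sum_congr rfl fun v _ => hK.bary_eq v.2 x

include hK in
lemma sum_bary_smul (x : E3) : ∑ v ∈ K, bary K v x • v = x := by
  conv_rhs => rw [← hK.basis.linear_combination_coord_eq_self x]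
  rw [← Finset.sum_attach]
  exact Finset.sum_congr rfl fun v _ => by rw [hK.bary_eq v.2 x]; rfl

include hK in
lemma bary_sum {w : E3 → ℝ} (hw : ∑ v ∈ K, w v = 1) {v : E3} (hv : v ∈ K) :
    bary K v (∑ u ∈ K, w u • u) = w v := by
  have hw' : ∑ i : K, w i = 1 := by
    rw [← hw, ← Finset.sum_attach K]
    rfl
  have e : ∑ u ∈ K, w u • u =
      Finset.univ.affineCombination ℝ hK.basis (fun i : K => w i) := by
    rw [Finset.affineCombination_eq_linear_combination _ _ _ hw', ← Finset.sum_attach]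
    rfl
  rw [hK.bary_eq hv, e, hK.basis.coord_apply_combination_of_mem (Finset.mem_univ _) hw']

include hK in
lemma bary_self {v : E3} (hv : v ∈ K) : bary K v v = 1 := by
  rw [hK.bary_eq hv]
  exact hK.basis.coord_apply_eq ⟨v, hv⟩

include hK in
lemma bary_vertex_ne {u v : E3} (hu : u ∈ K) (h : u ≠ v) : bary K v u = 0 := by
  by_cases hv : v ∈ K
  · rw [hK.bary_eq hv]
    exact hK.basis.coord_apply_ne (i := ⟨v, hv⟩) (j := ⟨u, hu⟩)
      fun e => h (congrArg Subtype.val e).symm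
  · exact bary_of_notMem hv u

include hK in
-- Covers both the homotheties centred at a vertex and the translations used in the open star
-- argument.
lemma bary_smul_sub_add (c : ℝ) (v x y z : E3) :
    bary K v (c • (x - y) + z) = c * (bary K v x - bary K v y) + bary K v z := by
  by_cases hv : v ∈ K
  · simp only [hK.bary_eq hv]
    have h1 := (hK.basis.coord ⟨v, hv⟩).map_vadd z (c • (x - y))
    have h2 := (hK.basis.coord ⟨v, hv⟩).linearMap_vsub x y
    simp only [vadd_eq_add, vsub_eq_sub] at h1 h2
    rw [h1, map_smul, h2, smul_eq_mul]
  · simp only [bary_of_notMem hv]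
    ring

include hK in
lemma mem_convexHull_iff {x : E3} :
    x ∈ convexHull ℝ (K : Set E3) ↔ ∀ v ∈ K, 0 ≤ bary K v x := by
  rw [← hK.range_basis, hK.basis.convexHull_eq_nonneg_coord]
  refine ⟨fun h v hv => ?_, fun h i => ?_⟩
  · rw [hK.bary_eq hv]; exact h _
  · rw [← hK.bary_eq i.2]; exact h _ i.2

include hK in
lemma mem_interior_convexHull_iff {x : E3} :
    x ∈ interior (convexHull ℝ (K : Set E3)) ↔ ∀ v ∈ K, 0 < bary K v x := by
  rw [← hK.range_basis, hK.basis.interior_convexHull]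
  refine ⟨fun h v hv => ?_, fun h i => ?_⟩
  · rw [hK.bary_eq hv]; exact h _
  · rw [← hK.bary_eq i.2]; exact h _ i.2

include hK in
-- The condition may range over all points v because the coordinate is 0 by default off K.
lemma mem_convexHull_face_iff {s : Finset E3} (hs : s ⊆ K) {x : E3} :
    x ∈ convexHull ℝ (s : Set E3) ↔
      x ∈ convexHull ℝ (K : Set E3) ∧ ∀ v, v ∉ s → bary K v x = 0 := by
  classical
  constructor
  · intro hx
    refine ⟨convexHull_mono (Finset.coe_subset.2 hs) hx, fun v hv => ?_⟩
    by_cases hvK : v ∈ K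
    · obtain ⟨w, -, hw1, hwx⟩ := Finset.mem_convexHull'.1 hx
      have h1 : ∑ u ∈ K, (if u ∈ s then w u else 0) = 1 := by
        rw [← hw1, ← Finset.sum_filter, Finset.filter_mem_eq_inter, Finset.inter_eq_right.2 hs]
      have h2 : ∑ u ∈ K, (if u ∈ s then w u else 0) • u = x := by
        rw [← hwx]
        simp only [ite_smul, zero_smul]
        rw [← Finset.sum_filter, Finset.filter_mem_eq_inter, Finset.inter_eq_right.2 hs]
      have h3 := hK.bary_sum h1 hvK
      rw [h2, if_neg hv] at h3
      exact h3
    · exact bary_of_notMem hvK x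
  · rintro ⟨hx, h0⟩
    have hz : ∀ v ∈ K, v ∉ s → bary K v x = 0 := fun v _ hv => h0 v hv
    refine Finset.mem_convexHull'.2 ⟨fun v => bary K v x,
      fun v hv => hK.mem_convexHull_iff.1 hx v (hs hv), ?_, ?_⟩
    · rw [Finset.sum_subset hs hz, hK.sum_bary]
    · rw [Finset.sum_subset hs fun v hv hvs => by
          beta_reduce; rw [hz v hv hvs, zero_smul],
        hK.sum_bary_smul]

/-- The expansion of x in K uses only vertices of K ∩ K', so it is also its expansion in K';
uniqueness of barycentric coordinates does the rest. -/
lemma bary_congr {K' : Finset E3} (hK : IsTet K) (hK' : IsTet K') {x : E3}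
    (hx : x ∈ convexHull ℝ ((K : Set E3) ∩ K')) (v : E3) : bary K v x = bary K' v x := by
  classical
  rw [← Finset.coe_inter] at hx
  have h1 := ((hK.mem_convexHull_face_iff Finset.inter_subset_left).1 hx).2
  have h2 := ((hK'.mem_convexHull_face_iff Finset.inter_subset_right).1 hx).2
  by_cases hv : v ∈ K ∩ K'
  · have hz : ∀ u ∈ K', u ∉ K ∩ K' → bary K u x = 0 := fun u _ hu => h1 u hu
    have hz' : ∀ u ∈ K, u ∉ K ∩ K' → bary K u x = 0 := fun u _ hu => h1 u hu
    have e1 : ∑ u ∈ K', bary K u x = 1 := by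
      rw [← Finset.sum_subset Finset.inter_subset_right hz,
        Finset.sum_subset Finset.inter_subset_left hz', hK.sum_bary]
    have e2 : ∑ u ∈ K', bary K u x • u = x := by
      rw [← Finset.sum_subset Finset.inter_subset_right fun u hu hu' => by
          rw [hz u hu hu', zero_smul],
        Finset.sum_subset Finset.inter_subset_left fun u hu hu' => by
          rw [hz' u hu hu', zero_smul], hK.sum_bary_smul]
    have e3 := hK'.bary_sum e1 (Finset.mem_inter.1 hv).2
    rw [e2] at e3
    exact e3.symm
  · rw [h1 v hv, h2 v hv]

include hK in
lemma contDiff_bary (v : E3) : ContDiff ℝ ∞ (bary K v) := by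
  by_cases hv : v ∈ K
  · rw [show bary K v = hK.basis.coord ⟨v, hv⟩ from funext (hK.bary_eq hv)]
    exact ContinuousAffineMap.contDiff
      ⟨hK.basis.coord ⟨v, hv⟩, AffineMap.continuous_of_finiteDimensional _⟩
  · rw [show bary K v = fun _ => 0 from funext (bary_of_notMem hv)]
    exact contDiff_const

include hK in
lemma exists_mvPolynomial_bary (v : E3) : ∃ P : MvPolynomial (Fin 3) ℝ, P.totalDegree ≤ 1 ∧
    ∀ x : E3, bary K v x = MvPolynomial.eval (fun i => x i) P := by
  by_cases hv : v ∈ K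
  · set l := hK.basis.coord ⟨v, hv⟩ with hl
    refine ⟨MvPolynomial.C (l 0) + ∑ i : Fin 3, MvPolynomial.C (l.linear (EuclideanSpace.single i 1))
      * MvPolynomial.X i, ?_, fun x => ?_⟩
    · refine (MvPolynomial.totalDegree_add _ _).trans (max_le (by simp) ?_)
      refine (MvPolynomial.totalDegree_finsetSum _ _).trans (Finset.sup_le fun i _ => ?_)
      refine (MvPolynomial.totalDegree_mul _ _).trans ?_
      simp
    · rw [hK.bary_eq hv, ← hl]
      have h1 := l.map_vadd 0 x
      simp only [vadd_eq_add, add_zero] at h1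
      have h2 : x = ∑ i, x i • EuclideanSpace.single i (1 : ℝ) := by
        ext j
        simp [Fin.sum_univ_three]
        fin_cases j <;> simp
      rw [h1]
      conv_lhs => rw [h2]
      rw [map_sum]
      simp [mul_comm, add_comm]
  · exact ⟨0, by simp, fun x => by simp [bary_of_notMem hv]⟩

include hK in
lemma mem_intrinsicInterior_convexHull_face {s : Finset E3} (hs : s ⊆ K) {x : E3}
    (hx : x ∈ convexHull ℝ (s : Set E3)) (h : ∀ v ∈ s, 0 < bary K v x) :
    x ∈ intrinsicInterior ℝ (convexHull ℝ (s : Set E3)) := by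
  -- Inside the affine span of the face the other coordinates vanish identically, so only finitely
  -- many strict inequalities have to persist near x.
  have h0 : ∀ y ∈ affineSpan ℝ (convexHull ℝ (s : Set E3)), ∀ v, v ∉ s → bary K v y = 0 := by
    intro y hy v hv
    refine affineSpan_induction (p := fun y => bary K v y = 0) hy
      (fun z hz => ((hK.mem_convexHull_face_iff hs).1 hz).2 v hv) fun c a b d ha hb hd => ?_
    rw [vsub_eq_sub, vadd_eq_add, hK.bary_smul_sub_add, ha, hb, hd]
    ring
  refine mem_intrinsicInterior.2 ⟨⟨x, subset_affineSpan ℝ _ hx⟩, ?_, rfl⟩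
  rw [mem_interior_iff_mem_nhds]
  have h1 : ∀ᶠ y : affineSpan ℝ (convexHull ℝ (s : Set E3)) in
      𝓝 ⟨x, subset_affineSpan ℝ _ hx⟩, ∀ v ∈ s, 0 < bary K v y := by
    refine (Filter.eventually_all_finset s).2 fun v hv => ?_
    exact (isOpen_lt continuous_const ((continuous_bary K v).comp continuous_subtype_val)).mem_nhds
      (h v hv)
  filter_upwards [h1] with y hy
  refine (hK.mem_convexHull_face_iff hs).2 ⟨hK.mem_convexHull_iff.2 fun v _ => ?_, h0 y y.2⟩
  by_cases hv : v ∈ s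
  · exact (hy v hv).le
  · exact (h0 y y.2 v hv).ge

/-! ### Nodal points and shape functions -/

variable {p : ℕ} {α : E3 → ℕ}

include hK in
lemma bary_node (hp : 1 ≤ p) (hα : α ∈ multiIndices p K) (v : E3) :
    bary K v (node p K α) = (α v : ℝ) / p := by
  obtain ⟨h1, h2⟩ := Finset.mem_piAntidiag.1 hα
  by_cases hv : v ∈ K
  · refine hK.bary_sum (w := fun v => (α v : ℝ) / p) ?_ hv
    rw [← Finset.sum_div, ← Nat.cast_sum, h1, div_self]
    exact_mod_cast (by omega : p ≠ 0)
  · rw [bary_of_notMem hv]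
    have : α v = 0 := by
      by_contra h
      exact hv (h2 v h)
    rw [this]
    simp

include hK in
lemma node_mem_convexHull (hp : 1 ≤ p) (hα : α ∈ multiIndices p K) :
    node p K α ∈ convexHull ℝ (K : Set E3) :=
  hK.mem_convexHull_iff.2 fun v _ => by rw [hK.bary_node hp hα]; positivity

/-- Multi-indices are functions on the whole space, zero off the simplex, so a node shared by two
tetrahedra carries a single multi-index. This is how compatibility across facets is expressed. -/
lemma multiIndices_eq_of_node_eq {K' : Finset E3} {β : E3 → ℕ} (hK : IsTet K) (hK' : IsTet K')
    (hp : 1 ≤ p) (hα : α ∈ multiIndices p K) (hβ : β ∈ multiIndices p K')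
    (hx : node p K α ∈ convexHull ℝ ((K : Set E3) ∩ K')) (h : node p K α = node p K' β) :
    α = β := by
  funext v
  have h1 := hK.bary_congr hK' hx v
  rw [hK.bary_node hp hα, h, hK'.bary_node hp hβ] at h1
  have hp' : (p : ℝ) ≠ 0 := by exact_mod_cast (by omega : p ≠ 0)
  exact_mod_cast (div_left_inj' hp').1 h1

include hK in
lemma contDiff_shape : ContDiff ℝ ∞ (shape p K α) := by
  unfold shape
  refine contDiff_prod fun v _ => contDiff_prod fun j _ => ?_
  exact ((contDiff_const.mul (hK.contDiff_bary v)).sub contDiff_const).div_const _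

include hK in
lemma exists_mvPolynomial_shape (hα : α ∈ multiIndices p K) :
    ∃ P : MvPolynomial (Fin 3) ℝ, P.totalDegree ≤ p ∧
      ∀ x : E3, shape p K α x = MvPolynomial.eval (fun i => x i) P := by
  choose P hP hPe using hK.exists_mvPolynomial_bary
  refine ⟨∏ v ∈ K, ∏ j ∈ Finset.range (α v),
    MvPolynomial.C ((α v : ℝ) - j)⁻¹ * (MvPolynomial.C (p : ℝ) * P v - MvPolynomial.C (j : ℝ)),
    ?_, fun x => ?_⟩
  -- The shape function is a product of as many affine factors as the entries of α sum to, which is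
  -- p.
  · rw [← (Finset.mem_piAntidiag.1 hα).1]
    refine (MvPolynomial.totalDegree_finsetProd _ _).trans (Finset.sum_le_sum fun v _ => ?_)
    refine (MvPolynomial.totalDegree_finsetProd _ _).trans ?_
    refine (Finset.sum_le_card_nsmul _ _ 1 fun j _ => ?_).trans (by simp)
    refine (MvPolynomial.totalDegree_mul _ _).trans ?_
    rw [MvPolynomial.totalDegree_C, zero_add]
    refine (MvPolynomial.totalDegree_sub _ _).trans (max_le ?_
      (MvPolynomial.totalDegree_C _ |>.trans_le zero_le_one))
    refine (MvPolynomial.totalDegree_mul _ _).trans ?_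
    rw [MvPolynomial.totalDegree_C, zero_add]
    exact hP v
  · simp only [shape, map_prod, map_mul, map_sub, MvPolynomial.eval_C, ← hPe, div_eq_inv_mul]

end IsTet

lemma shape_eq_zero {p : ℕ} {K : Finset E3} {α : E3 → ℕ} {v x : E3} (hv : v ∈ K) (hα : α v ≠ 0)
    (hx : bary K v x = 0) : shape p K α x = 0 := by
  refine Finset.prod_eq_zero hv (Finset.prod_eq_zero (Finset.mem_range.2 (Nat.pos_of_ne_zero hα)) ?_)
  simp [hx]

/-- The piecewise polynomial with coefficients `w`, on the tetrahedron `K`. -/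
def interp (p : ℕ) (w : (E3 → ℕ) → ℝ) (K : Finset E3) (x : E3) : ℝ :=
  ∑ α ∈ multiIndices p K, w α * shape p K α x

/-- Continuity across common faces. There the shape functions with an index outside K ∩ K' vanish,
and the others involve only common vertices, whose coordinates agree. -/
lemma interp_congr {p : ℕ} (w : (E3 → ℕ) → ℝ) {K K' : Finset E3} (hK : IsTet K) (hK' : IsTet K')
    {x : E3} (hx : x ∈ convexHull ℝ ((K : Set E3) ∩ K')) : interp p w K x = interp p w K' x := by
  classical
  have key : ∀ {K K' : Finset E3}, IsTet K → IsTet K' →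
      x ∈ convexHull ℝ ((K : Set E3) ∩ K') → interp p w K x =
        ∑ α ∈ multiIndices p (K ∩ K'), w α * ∏ v ∈ K ∩ K', ∏ j ∈ Finset.range (α v),
          ((p : ℝ) * bary K v x - (j : ℝ)) / ((α v : ℝ) - (j : ℝ)) := by
    intro K K' hK hK' hx
    rw [← Finset.coe_inter] at hx
    have h1 := ((hK.mem_convexHull_face_iff Finset.inter_subset_left).1 hx).2
    have hsub : multiIndices p (K ∩ K') ⊆ multiIndices p K := by
      intro α hα
      obtain ⟨a, b⟩ := Finset.mem_piAntidiag.1 hα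
      refine Finset.mem_piAntidiag.2 ⟨?_, fun v hv => Finset.inter_subset_left (b v hv)⟩
      rw [← a]
      exact (Finset.sum_subset Finset.inter_subset_left fun v _ hv =>
        not_not.1 fun h => hv (b v h)).symm
    unfold interp
    rw [← Finset.sum_subset hsub]
    · refine Finset.sum_congr rfl fun α hα => ?_
      obtain ⟨a, b⟩ := Finset.mem_piAntidiag.1 hα
      congr 1
      refine (Finset.prod_subset Finset.inter_subset_left fun v _ hv => ?_).symm
      have : α v = 0 := not_not.1 fun h => hv (b v h)
      simp [this]
    · intro α hα hα'
      obtain ⟨a, b⟩ := Finset.mem_piAntidiag.1 hα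
      obtain ⟨v, hv, hvs⟩ : ∃ v, α v ≠ 0 ∧ v ∉ K ∩ K' := by
        by_contra! h
        refine hα' (Finset.mem_piAntidiag.2 ⟨?_, h⟩)
        rw [← a]
        exact Finset.sum_subset Finset.inter_subset_left fun v _ hv =>
          not_not.1 fun h' => hv (h v h')
      rw [shape_eq_zero (b v hv) hv (h1 v hvs), mul_zero]
  rw [key hK hK' hx, key hK' hK (by rwa [Set.inter_comm]), Finset.inter_comm K' K]
  refine Finset.sum_congr rfl fun α _ => ?_
  simp only [hK.bary_congr hK' hx]

open Classical in
lemma interp_vertex {p : ℕ} (w : (E3 → ℕ) → ℝ) {K : Finset E3} (hK : IsTet K) {v : E3}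
    (hv : v ∈ K) : interp p w K v = w (Pi.single v p) := by
  unfold interp
  rw [Finset.sum_eq_single (Pi.single v p)]
  · suffices h : shape p K (Pi.single v p) v = 1 by rw [h, mul_one]
    refine Finset.prod_eq_one fun u hu => ?_
    by_cases huv : u = v
    · subst huv
      refine Finset.prod_eq_one fun j hj => ?_
      rw [Pi.single_eq_same] at hj ⊢
      rw [hK.bary_self hu, mul_one, div_self]
      have : (j : ℝ) < p := by exact_mod_cast Finset.mem_range.1 hj
      linarith
    · simp [Pi.single_eq_of_ne huv]
  · intro α hα hne
    obtain ⟨a, b⟩ := Finset.mem_piAntidiag.1 hα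
    obtain ⟨u, huv, hu⟩ : ∃ u, u ≠ v ∧ α u ≠ 0 := by
      by_contra! h
      refine hne (funext fun u => ?_)
      by_cases huv : u = v
      · subst huv
        rw [Pi.single_eq_same, ← a]
        exact (Finset.sum_eq_single u (fun t _ ht => h t ht) (fun h => absurd hv h)).symm
      · rw [Pi.single_eq_of_ne huv, h u huv]
    rw [shape_eq_zero (b u hu) hu (hK.bary_vertex_ne hv huv.symm), mul_zero]
  · intro h
    refine absurd (Finset.mem_piAntidiag.2 ⟨?_, fun u hu => ?_⟩) h
    · rw [Finset.sum_eq_single v (fun u _ hu => Pi.single_eq_of_ne hu _) (fun h => absurd hv h),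
        Pi.single_eq_same]
    · by_contra hu'
      exact hu (Pi.single_eq_of_ne (fun e : u = v => hu' (e.symm ▸ hv)) _)

end CrouzeixRaviart
end

noncomputable section
open CrouzeixRaviart

namespace TetMesh

variable {Ω : Set E3} (G : TetMesh Ω)

/-! ### Geometry of a mesh -/

variable {G}

lemma mem_simplices {m : ℕ} {s : Finset E3} :
    s ∈ G.simplices m ↔ s ∈ G.complex.faces ∧ s.card = m := by
  simp [simplices]

lemma mem_faces_of_mem_tets {K : Finset E3} (hK : K ∈ G.tets) : K ∈ G.complex.faces :=
  (mem_simplices.1 hK).1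

lemma isTet_of_mem_tets {K : Finset E3} (hK : K ∈ G.tets) : IsTet K := by
  obtain ⟨h1, h2⟩ := mem_simplices.1 hK
  refine ⟨G.complex.indep h1, ?_⟩
  refine (G.complex.indep h1).affineSpan_eq_top_iff_card_eq_finrank_add_one.2 ?_
  simp [h2]

lemma mem_convexHull_inter {K K' : Finset E3} (hK : K ∈ G.tets) (hK' : K' ∈ G.tets) {x : E3}
    (hx : x ∈ convexHull ℝ (K : Set E3)) (hx' : x ∈ convexHull ℝ (K' : Set E3)) :
    x ∈ convexHull ℝ ((K : Set E3) ∩ K') :=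
  G.complex.inter_subset_convexHull (mem_faces_of_mem_tets hK) (mem_faces_of_mem_tets hK') ⟨hx, hx'⟩

lemma convexHull_subset_closure {K : Finset E3} (hK : K ∈ G.tets) :
    convexHull ℝ (K : Set E3) ⊆ closure Ω := by
  rw [← G.space_eq]
  exact G.complex.convexHull_subset_space (mem_faces_of_mem_tets hK)

lemma exists_tet_of_mem_closure {x : E3} (hx : x ∈ closure Ω) :
    ∃ K ∈ G.tets, x ∈ convexHull ℝ (K : Set E3) := by
  rw [← G.space_eq, Geometry.SimplicialComplex.mem_space_iff] at hx
  obtain ⟨s, hs, hxs⟩ := hx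
  obtain ⟨K, hK, hsK, hcard⟩ := G.pure s hs
  exact ⟨K, mem_simplices.2 ⟨hK, hcard⟩, convexHull_mono (Finset.coe_subset.2 hsK) hxs⟩

lemma exists_tet_of_mem_vertices {v : E3} (hv : v ∈ G.vertices) : ∃ K ∈ G.tets, v ∈ K := by
  obtain ⟨K, hK, hsK, hcard⟩ := G.pure {v} hv
  exact ⟨K, mem_simplices.2 ⟨hK, hcard⟩, Finset.singleton_subset_iff.1 hsK⟩

lemma isClosed_convexHull (K : Finset E3) : IsClosed (convexHull ℝ (K : Set E3)) :=
  (K.finite_toSet.isCompact_convexHull ℝ).isClosed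

lemma isBounded (G : TetMesh Ω) : Bornology.IsBounded Ω := by
  have h : Bornology.IsBounded (⋃ K ∈ G.tets, convexHull ℝ (K : Set E3)) :=
    (Bornology.isBounded_biUnion_finset _).2 fun K _ =>
      (K.finite_toSet.isCompact_convexHull ℝ).isBounded
  refine h.subset fun x hx => ?_
  obtain ⟨K, hK, hxK⟩ := exists_tet_of_mem_closure (G := G) (subset_closure hx)
  exact Set.mem_biUnion hK hxK

/-- An interior point has all coordinates positive, while those off the common face vanish; hence K
⊆ K', and both have four vertices. -/
lemma eq_of_mem_interior {K K' : Finset E3} (hK : K ∈ G.tets) (hK' : K' ∈ G.tets) {x : E3}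
    (hx : x ∈ interior (convexHull ℝ (K : Set E3))) (hx' : x ∈ convexHull ℝ (K' : Set E3)) :
    K = K' := by
  classical
  have h := mem_convexHull_inter hK hK' (interior_subset hx) hx'
  rw [← Finset.coe_inter] at h
  have hT := isTet_of_mem_tets hK
  have h0 := ((hT.mem_convexHull_face_iff Finset.inter_subset_left).1 h).2
  have hpos := hT.mem_interior_convexHull_iff.1 hx
  refine Finset.eq_of_subset_of_card_le (fun v hv => ?_) ?_
  · by_contra hv'
    exact (hpos v hv).ne' (h0 v fun h => hv' (Finset.mem_inter.1 h).2)
  · rw [(mem_simplices.1 hK).2, (mem_simplices.1 hK').2]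

/-- The open star of an interior vertex lies in `Ω`. -/
lemma mem_of_bary_pos (hΩ : Ω = interior (closure Ω)) {V : E3} (hV : V ∈ Ω) {K : Finset E3}
    (hK : K ∈ G.tets) {x : E3} (hx : x ∈ convexHull ℝ (K : Set E3)) (hpos : 0 < bary K V x) :
    x ∈ Ω := by
  classical
  have hT := isTet_of_mem_tets hK
  have hVK : V ∈ K := by
    by_contra h
    exact hpos.ne' (bary_of_notMem h x)
  have hopen : IsOpen Ω := by rw [hΩ]; exact isOpen_interior
  have hlim : Tendsto (fun ε : ℝ => ε • (x - V) + V) (𝓝[>] 0) (𝓝 V) := by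
    have : Continuous fun ε : ℝ => ε • (x - V) + V := by fun_prop
    have h := this.tendsto 0
    simp only [zero_smul, zero_add] at h
    exact h.mono_left nhdsWithin_le_nhds
  obtain ⟨ε, ⟨hεΩ, hε1⟩, hε0⟩ := ((hlim.eventually (hopen.mem_nhds hV)).and
    ((gt_mem_nhds (zero_lt_one' ℝ)).filter_mono nhdsWithin_le_nhds)
    |>.and self_mem_nhdsWithin).exists
  -- M is x contracted towards V far enough to lie in Ω. It has the same zero coordinates as x,
  -- hence lies in the same faces.
  set M := ε • (x - V) + V with hM
  have hMb : ∀ v ∈ K, bary K v M = ε * bary K v x + (1 - ε) * bary K v V := fun v _ => by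
    rw [hM, hT.bary_smul_sub_add]; ring
  have hVb : ∀ v, 0 ≤ bary K v V := fun v => by
    by_cases hv : V = v
    · subst hv; rw [hT.bary_self hVK]; exact zero_le_one
    · rw [hT.bary_vertex_ne hVK hv]
  have hxb := hT.mem_convexHull_iff.1 hx
  have hMK : M ∈ convexHull ℝ (K : Set E3) := hT.mem_convexHull_iff.2 fun v hv => by
    rw [hMb v hv]
    have := mul_nonneg hε0.le (hxb v hv)
    have := mul_nonneg (sub_pos.2 hε1).le (hVb v)
    linarith
  have hM0 : ∀ v, bary K v M = 0 ↔ bary K v x = 0 := fun v => by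
    by_cases hv : v ∈ K
    · rw [hMb v hv]
      by_cases hvV : V = v
      · subst hvV
        rw [hT.bary_self hVK]
        have := mul_pos hε0 hpos
        constructor <;> intro h <;> linarith
      · rw [hT.bary_vertex_ne hVK hvV]
        simp [hε0.ne']
    · simp [bary_of_notMem hv]
  rw [hΩ, mem_interior_iff_mem_nhds]
  -- A point y near x is translated to a point near M, which lies in Ω and so in some tetrahedron
  -- K'; for y close to x, this K' contains M and therefore x.
  have htr : Tendsto (fun y => (1 : ℝ) • (y - x) + M) (𝓝 x) (𝓝 M) := by
    have : Continuous fun y => (1 : ℝ) • (y - x) + M := by fun_prop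
    have h := this.tendsto x
    simpa using h
  have h1 : ∀ᶠ z in 𝓝 M, ∀ K' ∈ G.tets, z ∈ convexHull ℝ (K' : Set E3) →
      M ∈ convexHull ℝ (K' : Set E3) := by
    refine (Filter.eventually_all_finset _).2 fun K' _ => ?_
    by_cases hMK' : M ∈ convexHull ℝ (K' : Set E3)
    · exact Eventually.of_forall fun _ _ => hMK'
    · filter_upwards [(isClosed_convexHull K').isOpen_compl.mem_nhds hMK'] with z hz hz'
      exact absurd hz' hz
  have h2 : ∀ᶠ y in 𝓝 x, ∀ K' ∈ G.tets, ∀ v ∈ K', 0 < bary K' v x → 0 < bary K' v y := by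
    refine (Filter.eventually_all_finset _).2 fun K' _ => (Filter.eventually_all_finset _).2
      fun v _ => ?_
    by_cases h : 0 < bary K' v x
    · filter_upwards [(isOpen_lt continuous_const (continuous_bary K' v)).mem_nhds h] with y hy _
      exact hy
    · exact Eventually.of_forall fun _ h' => absurd h' h
  filter_upwards [h2, htr.eventually h1, htr.eventually (hopen.mem_nhds hεΩ)] with y hy2 hy1 hyΩ
  obtain ⟨K', hK', hzK'⟩ := exists_tet_of_mem_closure (G := G) (subset_closure hyΩ)
  have hT' := isTet_of_mem_tets hK'
  have hMK' := hy1 K' hK' hzK'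
  have hMI := mem_convexHull_inter hK hK' hMK hMK'
  have hMI' := hMI
  rw [← Finset.coe_inter, hT.mem_convexHull_face_iff Finset.inter_subset_left] at hMI'
  have hxI : x ∈ convexHull ℝ ((K : Set E3) ∩ K') := by
    rw [← Finset.coe_inter, hT.mem_convexHull_face_iff Finset.inter_subset_left]
    exact ⟨hx, fun v hv => (hM0 v).1 (hMI'.2 v hv)⟩
  refine convexHull_subset_closure hK' (hT'.mem_convexHull_iff.2 fun v hv => ?_)
  have hz := hT'.mem_convexHull_iff.1 hzK' v hv
  rw [hT'.bary_smul_sub_add, ← hT.bary_congr hT' hMI, ← hT.bary_congr hT' hxI] at hz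
  -- Coordinates that vanish at x vanish at M, so y inherits nonnegativity from its translate;
  -- coordinates positive at x stay positive near x. Hence a neighbourhood of x lies in the closure
  -- of Ω.
  by_cases hvx : bary K v x = 0
  · rw [(hM0 v).2 hvx, hvx] at hz
    linarith
  · refine (hy2 K' hK' v hv ?_).le
    rw [← hT.bary_congr hT' hxI]
    refine lt_of_le_of_ne ?_ (Ne.symm hvx)
    by_cases hvK : v ∈ K
    · exact hxb v hvK
    · rw [bary_of_notMem hvK]

/-! ### Gluing piecewise polynomials -/

/-- A continuous function which is Lipschitz on each member of a finite cover is Lipschitz. -/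
lemma _root_.lipschitzWith_of_finite_cover {ι : Type*} {E : Type*} [NormedAddCommGroup E]
    [NormedSpace ℝ E] (t : Finset ι) (S : ι → Set E) (hS : ∀ x, ∃ i ∈ t, x ∈ S i) {f : E → ℝ}
    (hf : Continuous f) {L : NNReal} (hL : ∀ i ∈ t, LipschitzOnWith L f (S i)) :
    LipschitzWith (t.card * L) f := by
  intro x y
  -- The members of the cover need not be convex. The image of the segment contains the whole
  -- interval between the end values and is covered by finitely many sets of diameter at most L
  -- times the distance; comparing lengths gives the bound.
  have hconn : Set.uIcc (f x) (f y) ⊆ f '' segment ℝ x y := by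
    have : IsPreconnected (f '' segment ℝ x y) :=
      ((convex_segment x y).isPreconnected).image f hf.continuousOn
    exact this.ordConnected.uIcc_subset ⟨x, left_mem_segment ℝ x y, rfl⟩
      ⟨y, right_mem_segment ℝ x y, rfl⟩
  have hcov : f '' segment ℝ x y ⊆ ⋃ i ∈ t, f '' (S i ∩ segment ℝ x y) := by
    rintro _ ⟨z, hz, rfl⟩
    obtain ⟨i, hi, hzi⟩ := hS z
    exact Set.mem_biUnion hi ⟨z, ⟨hzi, hz⟩, rfl⟩
  calc edist (f x) (f y) = volume (Set.uIcc (f x) (f y)) := by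
        rw [Real.volume_interval, edist_comm, edist_dist, Real.dist_eq]
    _ ≤ ∑ i ∈ t, volume (f '' (S i ∩ segment ℝ x y)) :=
        (measure_mono (hconn.trans hcov)).trans (measure_biUnion_finset_le _ _)
    _ ≤ ∑ i ∈ t, (L : ENNReal) * edist x y := by
        refine Finset.sum_le_sum fun i hi => (Real.volume_le_diam _).trans ?_
        refine Metric.ediam_le ?_
        rintro _ ⟨a, ⟨haS, ha⟩, rfl⟩ _ ⟨b, ⟨hbS, hb⟩, rfl⟩
        refine (hL i hi haS hbS).trans (mul_le_mul_right ?_ _)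
        refine (Metric.edist_le_ediam_of_mem ha hb).trans ?_
        rw [← convexHull_pair, convexHull_ediam, Metric.ediam_pair]
    _ = _ := by
        rw [Finset.sum_const, nsmul_eq_mul, ← mul_assoc]
        push_cast
        rfl

open Classical in
variable (G) in
/-- The function on the closure of `Ω` that is given by compatible functions `F K` on the
tetrahedra, extended by zero. -/
def glue (F : Finset E3 → E3 → ℝ) (x : E3) : ℝ :=
  if h : ∃ K ∈ G.tets, x ∈ convexHull ℝ (K : Set E3) then F h.choose x else 0

section Glue

variable {F : Finset E3 → E3 → ℝ}
  (hcomp : ∀ K ∈ G.tets, ∀ K' ∈ G.tets, ∀ x ∈ convexHull ℝ (K : Set E3),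
    x ∈ convexHull ℝ (K' : Set E3) → F K x = F K' x)

include hcomp in
lemma glue_eq {K : Finset E3} (hK : K ∈ G.tets) {x : E3} (hx : x ∈ convexHull ℝ (K : Set E3)) :
    G.glue F x = F K x := by
  have h : ∃ K ∈ G.tets, x ∈ convexHull ℝ (K : Set E3) := ⟨K, hK, hx⟩
  unfold glue
  rw [dif_pos h]
  exact hcomp _ h.choose_spec.1 _ hK x h.choose_spec.2 hx

variable (hzero : ∀ K ∈ G.tets, ∀ x ∈ convexHull ℝ (K : Set E3), x ∉ Ω → F K x = 0)

include hcomp hzero in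
lemma glue_eq_zero {x : E3} (hx : x ∉ Ω) : G.glue F x = 0 := by
  by_cases h : ∃ K ∈ G.tets, x ∈ convexHull ℝ (K : Set E3)
  · obtain ⟨K, hK, hxK⟩ := h
    rw [glue_eq hcomp hK hxK, hzero K hK x hxK hx]
  · unfold glue
    rw [dif_neg h]

include hcomp hzero in
lemma exists_lipschitzWith_glue (hopen : IsOpen Ω)
    (hF : ∀ K ∈ G.tets, ContDiff ℝ ∞ (F K)) : ∃ L, LipschitzWith L (G.glue F) := by
  -- The index `none` stands for the complement of Ω, where the glued function is zero; without it
  -- the tetrahedra would not cover the whole space.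
  let S : Option (Finset E3) → Set E3 := fun o =>
    o.elim Ωᶜ fun K => convexHull ℝ (K : Set E3)
  have hcov : ∀ x, ∃ i ∈ Finset.insertNone G.tets, x ∈ S i := by
    intro x
    by_cases hx : x ∈ Ω
    · obtain ⟨K, hK, hxK⟩ := exists_tet_of_mem_closure (G := G) (subset_closure hx)
      exact ⟨some K, Finset.some_mem_insertNone.2 hK, hxK⟩
    · exact ⟨none, Finset.none_mem_insertNone, hx⟩
  have hlip : ∀ i ∈ Finset.insertNone G.tets, ∃ L, LipschitzOnWith L (G.glue F) (S i) := by
    rintro (_ | K) hi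
    · refine ⟨0, fun x hx y hy => ?_⟩
      rw [glue_eq_zero hcomp hzero hx, glue_eq_zero hcomp hzero hy]
      simp
    · have hK := Finset.some_mem_insertNone.1 hi
      obtain ⟨L, hL⟩ := (((hF K hK).of_le (by simp)).locallyLipschitz.locallyLipschitzOn
        (s := convexHull ℝ (K : Set E3))).exists_lipschitzOnWith_of_compact
        (K.finite_toSet.isCompact_convexHull ℝ)
      refine ⟨L, fun x hx y hy => ?_⟩
      rw [glue_eq hcomp hK hx, glue_eq hcomp hK hy]
      exact hL hx hy
  have hclosed : ∀ i, IsClosed (S i) := by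
    rintro (_ | K)
    · exact hopen.isClosed_compl
    · exact isClosed_convexHull K
  choose! L hL using hlip
  have hcont : Continuous (G.glue F) := by
    refine (locallyFinite_of_finite fun i : Finset.insertNone G.tets => S i).continuous ?_
      (fun i => hclosed i) fun i => (hL i i.2).continuousOn
    refine Set.eq_univ_of_forall fun x => ?_
    obtain ⟨i, hi, hx⟩ := hcov x
    exact Set.mem_iUnion.2 ⟨⟨i, hi⟩, hx⟩
  refine ⟨_, lipschitzWith_of_finite_cover (Finset.insertNone G.tets) S hcov hcont
    (L := (Finset.insertNone G.tets).sup L) fun i hi => ?_⟩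
  exact (hL i hi).weaken (Finset.le_sup hi)

end Glue

end TetMesh
end

noncomputable section

open TetMesh

namespace CrouzeixRaviart

/-! ### Nodal values of the functions of reflection type -/

section ReflValue

variable {p : ℕ} {K : Finset E3}

/-- `reflValue` picks an arbitrary frame. Since the coordinate of the omitted vertex is 0, the sum
over the facet can be completed to a sum over K, after which the value depends on the frame only
through its first vertex. -/
lemma bRefl_facetFrame (hK : IsTet K) (hcard : K.card = 4) {N : E3} {t : E3 × E3 × E3}
    (ht : IsFacetFrame K N t) :
    (∃ u ∈ K, u ≠ t.1 ∧ bary K u N = 0) ∧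
      bRefl p 0 (bary K t.2.1 N) (bary K t.2.2 N) =
        edgePoly p (bary K t.1 N) - (∑ x ∈ K, edgePoly p (bary K x N)) / 3 + edgePoly p 0 / 3 := by
  classical
  obtain ⟨a, b, c⟩ := t
  obtain ⟨ha, hb, hc, hab, hac, hbc, hN⟩ := ht
  simp only at ha hb hc hab hac hbc hN ⊢
  have hs : ({a, b, c} : Finset E3) ⊆ K := by
    simp [Finset.insert_subset_iff, ha, hb, hc]
  have hs3 : ({a, b, c} : Finset E3).card = 3 := Finset.card_eq_three.2 ⟨a, b, c, hab, hac, hbc, rfl⟩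
  obtain ⟨u, hu⟩ : ∃ u, K \ {a, b, c} = {u} := by
    rw [← Finset.card_eq_one, Finset.card_sdiff_of_subset hs, hcard, hs3]
  have huK := Finset.mem_sdiff.1 (hu ▸ Finset.mem_singleton_self u)
  have hN' : N ∈ convexHull ℝ ((({a, b, c} : Finset E3)) : Set E3) := by simpa using hN
  have h0 : bary K u N = 0 := ((hK.mem_convexHull_face_iff hs).1 hN').2 u huK.2
  have hsum : ∀ g : E3 → ℝ, ∑ x ∈ K, g x = g u + (g a + g b + g c) := fun g => by
    rw [← Finset.sum_sdiff hs, hu, Finset.sum_singleton, Finset.sum_insert (by simp [hab, hac]),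
      Finset.sum_insert (by simp [hbc]), Finset.sum_singleton]
    ring
  refine ⟨⟨u, huK.1, fun e => huK.2 (by simp [e]), h0⟩, ?_⟩
  have h1 := hK.sum_bary N
  rw [hsum, h0] at h1
  rw [hsum, h0, bRefl_zero, show 1 - bary K b N - bary K c N = bary K a N by linarith]
  ring

lemma exists_facetFrame (hK : IsTet K) (hcard : K.card = 4) {N u v : E3} (hv : v ∈ K) (hu : u ∈ K)
    (huv : u ≠ v) (hN : N ∈ convexHull ℝ (K : Set E3)) (h0 : bary K u N = 0) :
    ∃ t, IsFacetFrame K N t ∧ t.1 = v := by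
  classical
  have hvu : v ∈ K.erase u := Finset.mem_erase.2 ⟨huv.symm, hv⟩
  obtain ⟨a, b, hab, hab'⟩ : ∃ a b, a ≠ b ∧ (K.erase u).erase v = {a, b} := by
    rw [← Finset.card_eq_two, Finset.card_erase_of_mem hvu, Finset.card_erase_of_mem hu, hcard]
  have ha : a ∈ (K.erase u).erase v := by rw [hab']; simp
  have hb : b ∈ (K.erase u).erase v := by rw [hab']; simp
  simp only [Finset.mem_erase] at ha hb
  refine ⟨(v, a, b), ⟨hv, ha.2.2, hb.2.2, ha.1.symm, hb.1.symm, hab, ?_⟩, rfl⟩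
  have e : ({v, a, b} : Set E3) = (K.erase u : Finset E3) := by
    rw [← Finset.insert_erase hvu, hab']
    simp
  simp only
  rw [e, hK.mem_convexHull_face_iff (Finset.erase_subset _ _)]
  refine ⟨hN, fun x hx => ?_⟩
  by_cases hxu : x = u
  · rw [hxu, h0]
  · exact bary_of_notMem (fun h => hx (Finset.mem_erase.2 ⟨hxu, h⟩)) N

-- The facets of K other than `K.erase v` are those containing v, and a node lies on one of them
-- exactly when a coordinate other than that of v vanishes.
open Classical in
lemma reflValue_erase (hp : 1 ≤ p) (hK : IsTet K) (hcard : K.card = 4) {v : E3} (hv : v ∈ K)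
    {α : E3 → ℕ} (hα : α ∈ multiIndices p K) :
    reflValue p 0 (K.erase v) K (node p K α) =
      if ∃ u ∈ K, u ≠ v ∧ α u = 0 then
        edgePoly p (α v / p) - (∑ x ∈ K, edgePoly p (α x / p)) / 3 + edgePoly p 0 / 3
      else 0 := by
  have hp' : (p : ℝ) ≠ 0 := by exact_mod_cast (by omega : p ≠ 0)
  have hb := hK.bary_node hp hα
  have h1 : ∀ t : E3 × E3 × E3, IsFacetFrame K (node p K α) t → t.1 ∉ K.erase v → t.1 = v :=
    fun t ht h => by
      by_contra h'
      exact h (Finset.mem_erase.2 ⟨h', ht.1⟩)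
  unfold reflValue
  split_ifs with h h2 h2
  · have hs := h.choose_spec
    have h3 := (bRefl_facetFrame (p := p) hK hcard hs.1).2
    rw [h1 _ hs.1 hs.2] at h3
    rw [h3]
    simp only [hb]
  · obtain ⟨u, hu, huv, hu0⟩ := (bRefl_facetFrame (p := p) hK hcard h.choose_spec.1).1
    rw [h1 _ h.choose_spec.1 h.choose_spec.2] at huv
    rw [hb, div_eq_zero_iff, or_iff_left hp', Nat.cast_eq_zero] at hu0
    exact absurd ⟨u, hu, huv, hu0⟩ h2
  · obtain ⟨u, hu, huv, hu0⟩ := h2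
    obtain ⟨t, ht, htv⟩ := exists_facetFrame hK hcard hv hu huv (hK.node_mem_convexHull hp hα)
      (by rw [hb, hu0]; simp)
    exact absurd ⟨t, ht, by rw [htv]; simp⟩ h
  · rfl

end ReflValue

open Classical in
/-- The value at the nodal point with multi-index `α` of the sum of the functions of reflection type
of all facets which contain the vertex `V`. -/
def starValue (p : ℕ) (V : E3) (α : E3 → ℕ) : ℝ :=
  if α V = 0 ∨ 4 ≤ (Function.support α).ncard then 0
  else if (Function.support α).ncard = 3 then
    (∑ᶠ u ∈ Function.support α, edgePoly p (α u / p)) / 3 - edgePoly p (α V / p)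
  else edgePoly p 0 - edgePoly p (α V / p)

lemma support_multiIndex {p : ℕ} {K : Finset E3} {α : E3 → ℕ} (hα : α ∈ multiIndices p K) :
    Function.support α = (K.filter fun v => α v ≠ 0 : Finset E3) := by
  ext v
  have := (Finset.mem_piAntidiag.1 hα).2 v
  simpa using this

-- The central computation. The right side does not mention K, so the values from neighbouring
-- tetrahedra agree at common nodes.
open Classical in
lemma sum_reflValue_erase {p : ℕ} (hp : 1 ≤ p) {K : Finset E3} (hK : IsTet K) (hcard : K.card = 4)
    {V : E3} (hV : V ∈ K) {α : E3 → ℕ} (hα : α ∈ multiIndices p K) :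
    ∑ v ∈ K.erase V, reflValue p 0 (K.erase v) K (node p K α) = starValue p V α := by
  set a : E3 → ℝ := fun v => edgePoly p (α v / p) with ha
  set S : ℝ := ∑ x ∈ K, a x with hS
  set q : ℝ := edgePoly p 0 with hq
  have ha0 : ∀ v, α v = 0 → a v = q := fun v hv => by simp [ha, hv, hq]
  have hSV : ∑ v ∈ K.erase V, a v = S - a V := by rw [hS, ← Finset.sum_erase_add K a hV]; ring
  -- With three summands, S cancels completely.
  have hall : ∑ v ∈ K.erase V, (a v - S / 3 + q / 3) = q - a V := by
    rw [Finset.sum_add_distrib, Finset.sum_sub_distrib, hSV, Finset.sum_const, Finset.sum_const,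
      Finset.card_erase_of_mem hV, hcard]
    simp only [Nat.add_one_sub_one, nsmul_eq_mul]
    push_cast
    ring
  have hterm : ∑ v ∈ K.erase V, reflValue p 0 (K.erase v) K (node p K α) =
      ∑ v ∈ K.erase V, if ∃ u ∈ K, u ≠ v ∧ α u = 0 then a v - S / 3 + q / 3 else 0 :=
    Finset.sum_congr rfl fun v hv => reflValue_erase hp hK hcard (Finset.mem_of_mem_erase hv) hα
  rw [hterm]
  have hsupp := support_multiIndex hα
  set Z := K.filter fun v => α v = 0 with hZ
  have hcardZ : Z.card + (Function.support α).ncard = 4 := by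
    rw [hsupp, Set.ncard_coe_finset, ← hcard]
    exact Finset.card_filter_add_card_filter_not fun v => α v = 0
  have hfull : (∀ v ∈ K.erase V, ∃ u ∈ K, u ≠ v ∧ α u = 0) →
      (∑ v ∈ K.erase V, if ∃ u ∈ K, u ≠ v ∧ α u = 0 then a v - S / 3 + q / 3 else 0) = q - a V := by
    intro h
    rw [← hall]
    exact Finset.sum_congr rfl fun v hv => if_pos (h v hv)
  unfold starValue
  by_cases hV0 : α V = 0
  · rw [if_pos (Or.inl hV0), hfull fun v hv => ⟨V, hV, (Finset.ne_of_mem_erase hv).symm, hV0⟩,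
      ha0 V hV0, sub_self]
  by_cases h4 : 4 ≤ (Function.support α).ncard
  · rw [if_pos (Or.inr h4)]
    have hZ0 : Z = ∅ := Finset.card_eq_zero.1 (by omega)
    refine Finset.sum_eq_zero fun v _ => if_neg ?_
    rintro ⟨u, hu, -, hu0⟩
    have : u ∈ Z := Finset.mem_filter.2 ⟨hu, hu0⟩
    rw [hZ0] at this
    simp at this
  rw [if_neg (by tauto)]
  by_cases h3 : (Function.support α).ncard = 3
  · rw [if_pos h3]
    obtain ⟨z, hz⟩ : ∃ z, Z = {z} := Finset.card_eq_one.1 (by omega)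
    have hzZ : z ∈ K ∧ α z = 0 := Finset.mem_filter.1 (hz ▸ Finset.mem_singleton_self z : z ∈ Z)
    have hzV : z ∈ K.erase V := Finset.mem_erase.2 ⟨fun e => hV0 (e ▸ hzZ.2), hzZ.1⟩
    have hcond : ∀ v, (∃ u ∈ K, u ≠ v ∧ α u = 0) ↔ z ≠ v := fun v => by
      constructor
      · rintro ⟨u, hu, huv, hu0⟩
        have : u ∈ Z := Finset.mem_filter.2 ⟨hu, hu0⟩
        rw [hz, Finset.mem_singleton] at this
        rwa [← this]
      · exact fun h => ⟨z, hzZ.1, h, hzZ.2⟩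
    simp only [hcond]
    have h5 : ∑ᶠ u ∈ Function.support α, edgePoly p (α u / p) = S - q := by
      rw [hsupp, finsum_mem_coe_finset, hS,
        ← Finset.sum_filter_add_sum_filter_not K (fun v => α v = 0) a, ← hZ, hz,
        Finset.sum_singleton, ha0 z hzZ.2]
      ring
    rw [h5, ← Finset.sum_erase_add _ _ hzV, if_neg (by simp), add_zero,
      Finset.sum_congr rfl fun v hv => if_pos (Finset.ne_of_mem_erase hv).symm]
    -- With a single vanishing coordinate z, the summand of v = z is absent; it is subtracted from
    -- the full sum.
    have h6 := hall
    rw [← Finset.sum_erase_add _ _ hzV, ha0 z hzZ.2] at h6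
    change _ = (S - q) / 3 - a V
    linarith
  · rw [if_neg h3]
    have hone : 1 < Z.card := by omega
    refine hfull fun v _ => ?_
    obtain ⟨u, hu, huv⟩ := Finset.exists_mem_ne hone v
    exact ⟨u, (Finset.mem_filter.1 hu).1, huv, (Finset.mem_filter.1 hu).2⟩

open Classical in
lemma support_single {p : ℕ} (hp : 1 ≤ p) (V : E3) :
    Function.support (Pi.single V p : E3 → ℕ) = {V} := by
  rw [Pi.support_single_of_ne (by omega)]

open Classical in
lemma starValue_single {p : ℕ} (hp : 1 ≤ p) (V : E3) :
    starValue p V (Pi.single V p) = edgePoly p 0 - edgePoly p 1 := by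
  have hp' : (p : ℝ) ≠ 0 := by exact_mod_cast (by omega : p ≠ 0)
  have h : p ≠ 0 := by omega
  unfold starValue
  rw [support_single hp]
  simp [h, hp']

lemma starValue_eq_zero {p : ℕ} {V : E3} {α : E3 → ℕ} (h : α V = 0) : starValue p V α = 0 := by
  unfold starValue
  rw [if_pos (Or.inl h)]

end CrouzeixRaviart

end

noncomputable section
open CrouzeixRaviart

namespace TetMesh

variable {Ω : Set E3} {G : TetMesh Ω} {p : ℕ}

lemma card_of_mem_tets {K : Finset E3} (hK : K ∈ G.tets) : K.card = 4 := (mem_simplices.1 hK).2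

/-! ### Piecewise interpolation -/

lemma piecewiseInterp_congr {c c' : Finset E3 → E3 → ℝ}
    (h : ∀ K ∈ G.tets, ∀ α ∈ multiIndices p K, c K (node p K α) = c' K (node p K α)) :
    G.piecewiseInterp p c = G.piecewiseInterp p c' := by
  have e : G.piecewiseFun p c = G.piecewiseFun p c' := by
    funext x
    refine Finset.sum_congr rfl fun K hK => ?_
    congr 1
    funext y
    exact Finset.sum_congr rfl fun α hα => by rw [h K hK α hα]
  unfold piecewiseInterp
  simp only [e]

lemma piecewiseInterp_add (c c' : Finset E3 → E3 → ℝ) :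
    G.piecewiseInterp p (fun K N => c K N + c' K N) =
      G.piecewiseInterp p c + G.piecewiseInterp p c' := by
  have e : G.piecewiseFun p (fun K N => c K N + c' K N) =
      G.piecewiseFun p c + G.piecewiseFun p c' := by
    funext x
    simp only [piecewiseFun, Pi.add_apply, add_mul, Finset.sum_add_distrib]
    rw [← Finset.sum_add_distrib]
    refine Finset.sum_congr rfl fun K _ => ?_
    by_cases hx : x ∈ interior (convexHull ℝ (K : Set E3))
    · simp only [Set.indicator_of_mem hx]
    · simp only [Set.indicator_of_notMem hx, add_zero]
  unfold piecewiseInterp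
  simp only [e]
  rfl

lemma piecewiseInterp_smul (a : ℝ) (c : Finset E3 → E3 → ℝ) :
    G.piecewiseInterp p (fun K N => a * c K N) = a • G.piecewiseInterp p c := by
  have e : G.piecewiseFun p (fun K N => a * c K N) = a • G.piecewiseFun p c := by
    funext x
    simp only [piecewiseFun, Pi.smul_apply, smul_eq_mul, mul_assoc, ← Finset.mul_sum]
    rw [Finset.mul_sum]
    refine Finset.sum_congr rfl fun K _ => ?_
    by_cases hx : x ∈ interior (convexHull ℝ (K : Set E3))
    · simp only [Set.indicator_of_mem hx]
    · simp only [Set.indicator_of_notMem hx, mul_zero]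
  unfold piecewiseInterp
  simp only [e]
  rfl

lemma piecewiseInterp_zero : G.piecewiseInterp p (fun _ _ => 0) = 0 := by
  have h := piecewiseInterp_smul (G := G) (p := p) 0 (fun _ _ => 0)
  simpa using h

lemma piecewiseInterp_sum {ι : Type*} (t : Finset ι) (c : ι → Finset E3 → E3 → ℝ) :
    G.piecewiseInterp p (fun K N => ∑ i ∈ t, c i K N) = ∑ i ∈ t, G.piecewiseInterp p (c i) := by
  classical
  induction t using Finset.induction_on with
  | empty => simpa using piecewiseInterp_zero
  | insert i t hi ih =>
    simp only [Finset.sum_insert hi]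
    rw [piecewiseInterp_add, ih]

open Classical in
variable (G p) in
/-- The nodal points of the mesh as a finite set. -/
def nodeFinset : Finset E3 := G.tets.biUnion fun K => (multiIndices p K).image (node p K)

lemma mem_nodeFinset {N : E3} :
    N ∈ G.nodeFinset p ↔ ∃ K ∈ G.tets, ∃ α ∈ multiIndices p K, node p K α = N := by
  simp [nodeFinset]

lemma multiIndices_eq_of_node_eq (hp : 1 ≤ p) {K K' : Finset E3} (hK : K ∈ G.tets)
    (hK' : K' ∈ G.tets) {α β : E3 → ℕ} (hα : α ∈ multiIndices p K) (hβ : β ∈ multiIndices p K')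
    (h : node p K α = node p K' β) : α = β := by
  have hT := isTet_of_mem_tets hK
  have hT' := isTet_of_mem_tets hK'
  refine hT.multiIndices_eq_of_node_eq hT' hp hα hβ ?_ h
  refine mem_convexHull_inter hK hK' (hT.node_mem_convexHull hp hα) ?_
  rw [h]
  exact hT'.node_mem_convexHull hp hβ

lemma exists_nodal_function (hp : 1 ≤ p) (w : (E3 → ℕ) → ℝ) : ∃ W : E3 → ℝ, ∀ K ∈ G.tets,
    ∀ α ∈ multiIndices p K, W (node p K α) = w α := by
  classical
  refine ⟨fun N => if h : ∃ α, ∃ K ∈ G.tets, α ∈ multiIndices p K ∧ node p K α = N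
    then w h.choose else 0, fun K hK α hα => ?_⟩
  have h : ∃ β, ∃ K' ∈ G.tets, β ∈ multiIndices p K' ∧ node p K' β = node p K α :=
    ⟨α, K, hK, hα, rfl⟩
  beta_reduce
  rw [dif_pos h]
  obtain ⟨K', hK', hβ, he⟩ := h.choose_spec
  exact congrArg w (multiIndices_eq_of_node_eq hp hK' hK hβ hα he)

/-- Expansion of a continuous piecewise polynomial in the Lagrange basis. -/
lemma piecewiseInterp_eq_sum_lagrangeBasis (W : E3 → ℝ) :
    G.piecewiseInterp p (fun _ N => W N) = ∑ N ∈ G.nodeFinset p, W N • G.lagrangeBasis p N := by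
  classical
  unfold lagrangeBasis
  simp only [← piecewiseInterp_smul]
  rw [← piecewiseInterp_sum]
  refine piecewiseInterp_congr fun K hK α hα => ?_
  have : node p K α ∈ G.nodeFinset p := mem_nodeFinset.2 ⟨K, hK, α, hα, rfl⟩
  simp [this]

lemma interp_compatible (w : (E3 → ℕ) → ℝ) (K : Finset E3) (hK : K ∈ G.tets) (K' : Finset E3)
    (hK' : K' ∈ G.tets) (x : E3) (hx : x ∈ convexHull ℝ (K : Set E3))
    (hx' : x ∈ convexHull ℝ (K' : Set E3)) : interp p w K x = interp p w K' x :=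
  interp_congr w (isTet_of_mem_tets hK) (isTet_of_mem_tets hK')
    (mem_convexHull_inter hK hK' hx hx')

lemma measure_frontier_convexHull (K : Finset E3) :
    volume (frontier (convexHull ℝ (K : Set E3))) = 0 :=
  (convex_convexHull ℝ _).addHaar_frontier _

/-- Off the null set of frontiers, each point of Ω is interior to exactly one tetrahedron, so only
one indicator contributes. -/
lemma piecewiseInterp_ae_eq_glue (hopen : IsOpen Ω) {c : Finset E3 → E3 → ℝ} {w : (E3 → ℕ) → ℝ}
    (h : ∀ K ∈ G.tets, ∀ α ∈ multiIndices p K, c K (node p K α) = w α) :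
    G.piecewiseInterp p c =ᵐ[volume.restrict Ω] G.glue (interp p w) := by
  have h1 : ∀ᵐ x ∂(volume.restrict Ω), ∀ K ∈ G.tets,
      x ∉ frontier (convexHull ℝ (K : Set E3)) :=
    (Filter.eventually_all_finset _).2 fun K _ =>
      ae_restrict_of_ae (measure_eq_zero_iff_ae_notMem.1 (measure_frontier_convexHull K))
  have h2 : G.piecewiseInterp p c =ᵐ[volume.restrict Ω] G.piecewiseFun p c := AEEqFun.coeFn_mk _ _
  filter_upwards [h1, h2, ae_restrict_mem hopen.measurableSet] with x hx hx2 hxΩ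
  rw [hx2]
  obtain ⟨K, hK, hxK⟩ := exists_tet_of_mem_closure (G := G) (subset_closure hxΩ)
  have hxi : x ∈ interior (convexHull ℝ (K : Set E3)) := by
    by_contra hxi
    exact hx K hK ⟨subset_closure hxK, hxi⟩
  rw [glue_eq (interp_compatible w) hK hxK]
  unfold piecewiseFun
  rw [Finset.sum_eq_single_of_mem K hK, Set.indicator_of_mem hxi]
  · exact Finset.sum_congr rfl fun α hα => by rw [h K hK α hα]
  · intro K' hK' hne
    refine Set.indicator_of_notMem (fun hx' => hne ?_) _
    exact eq_of_mem_interior hK' hK hx' hxK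

section Conforming

variable {w : (E3 → ℕ) → ℝ}

lemma isConforming_glue (hopen : IsOpen Ω)
    (hzero : ∀ K ∈ G.tets, ∀ x ∈ convexHull ℝ (K : Set E3), x ∉ Ω → interp p w K x = 0) :
    G.IsConforming p (G.glue (interp p w)) := by
  obtain ⟨L, hL⟩ := exists_lipschitzWith_glue (interp_compatible w) hzero hopen fun K hK =>
    ContDiff.sum fun α _ => contDiff_const.mul ((isTet_of_mem_tets hK).contDiff_shape)
  refine ⟨hL.continuous.continuousOn, fun K hK => ?_,
    memH10_of_lipschitzWith G.isBounded hL fun x hx =>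
      glue_eq_zero (interp_compatible w) hzero hx⟩
  have hT := isTet_of_mem_tets hK
  have hP : ∀ α, ∃ P : MvPolynomial (Fin 3) ℝ, α ∈ multiIndices p K → P.totalDegree ≤ p ∧
      ∀ x : E3, shape p K α x = MvPolynomial.eval (fun i => x i) P := fun α => by
    by_cases hα : α ∈ multiIndices p K
    · obtain ⟨P, hP⟩ := hT.exists_mvPolynomial_shape hα
      exact ⟨P, fun _ => hP⟩
    · exact ⟨0, fun h => absurd h hα⟩
  choose P hP using hP
  refine ⟨∑ α ∈ multiIndices p K, w α • P α, ?_, fun x hx => ?_⟩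
  · refine (MvPolynomial.totalDegree_finsetSum _ _).trans (Finset.sup_le fun α hα => ?_)
    exact (MvPolynomial.totalDegree_smul_le _ _).trans (hP α hα).1
  · rw [glue_eq (interp_compatible w) hK hx, map_sum]
    exact Finset.sum_congr rfl fun α hα => by rw [MvPolynomial.smul_eval, (hP α hα).2 x]

end Conforming

/-! ### The conforming function of an interior vertex -/

-- For V in K the facets of K through V are obtained by erasing one other vertex, and all of them
-- are inner since they contain a point of the open set Ω.
open Classical in
lemma sum_reflValue (hopen : IsOpen Ω) (hp : 1 ≤ p) {V : E3} (hV : V ∈ Ω) {K : Finset E3}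
    (hK : K ∈ G.tets) {α : E3 → ℕ} (hα : α ∈ multiIndices p K) :
    (∑ T ∈ G.innerFacets with V ∈ T,
      if T ⊆ K then reflValue p 0 T K (node p K α) else 0) = starValue p V α := by
  have hcard := card_of_mem_tets hK
  by_cases hVK : V ∈ K
  · rw [← sum_reflValue_erase hp (isTet_of_mem_tets hK) hcard hVK hα, ← Finset.sum_filter]
    have e : ((G.innerFacets.filter fun T => V ∈ T).filter fun T => T ⊆ K) =
        (K.erase V).image fun v => K.erase v := by
      ext T
      simp only [Finset.mem_filter, Finset.mem_image, innerFacets, innerSimplices, mem_simplices]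
      constructor
      · rintro ⟨⟨⟨⟨-, hT3⟩, -⟩, hVT⟩, hTK⟩
        obtain ⟨v, hv⟩ : ∃ v, K \ T = {v} := by
          rw [← Finset.card_eq_one, Finset.card_sdiff_of_subset hTK, hcard, hT3]
        have hvK := Finset.mem_sdiff.1 (hv ▸ Finset.mem_singleton_self v)
        refine ⟨v, Finset.mem_erase.2 ⟨fun h => hvK.2 (h ▸ hVT), hvK.1⟩, ?_⟩
        rw [Finset.erase_eq, ← hv, Finset.sdiff_sdiff_eq_self hTK]
      · rintro ⟨v, hv, rfl⟩
        obtain ⟨hvV, hvK⟩ := Finset.mem_erase.1 hv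
        have hVe : V ∈ K.erase v := Finset.mem_erase.2 ⟨hvV.symm, hVK⟩
        refine ⟨⟨⟨⟨G.complex.down_closed (mem_faces_of_mem_tets hK) (Finset.erase_subset _ _)
          ⟨V, hVe⟩, by rw [Finset.card_erase_of_mem hvK, hcard]⟩, fun h => ?_⟩, hVe⟩,
          Finset.erase_subset _ _⟩
        have := h (subset_convexHull ℝ _ (Finset.mem_coe.2 hVe))
        rw [hopen.frontier_eq] at this
        exact this.2 hV
    rw [e, Finset.sum_image]
    intro u hu v hv huv
    by_contra h
    have : u ∈ K.erase v := Finset.mem_erase.2 ⟨h, Finset.mem_of_mem_erase hu⟩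
    rw [← show K.erase u = K.erase v from huv] at this
    simp at this
  · rw [starValue_eq_zero (not_not.1 fun h => hVK ((Finset.mem_piAntidiag.1 hα).2 V h))]
    refine Finset.sum_eq_zero fun T hT => if_neg fun h => hVK (h (Finset.mem_filter.1 hT).2)

/-- Outside Ω the coordinate of V is zero, so each term has either a vanishing nodal value (α V = 0)
or a vanishing shape function. -/
lemma interp_starValue_eq_zero (hΩ : Ω = interior (closure Ω)) {V : E3} (hV : V ∈ Ω) (a : ℝ)
    (K : Finset E3) (hK : K ∈ G.tets) (x : E3) (hx : x ∈ convexHull ℝ (K : Set E3)) (hxΩ : x ∉ Ω) :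
    interp p (fun α => a * starValue p V α) K x = 0 := by
  have h0 : bary K V x = 0 := by
    by_cases hVK : V ∈ K
    · refine le_antisymm (not_lt.1 fun h => hxΩ (mem_of_bary_pos hΩ hV hK hx h)) ?_
      exact (isTet_of_mem_tets hK).mem_convexHull_iff.1 hx V hVK
    · exact bary_of_notMem hVK x
  refine Finset.sum_eq_zero fun α hα => ?_
  by_cases hαV : α V = 0
  · beta_reduce; rw [starValue_eq_zero hαV]; ring
  · rw [shape_eq_zero ((Finset.mem_piAntidiag.1 hα).2 V hαV) hαV h0, mul_zero]

lemma lagrangeBasis_mem_of_starValue_ne_zero (hΩ : Ω = interior (closure Ω)) (hp : 1 ≤ p) {V : E3}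
    (hV : V ∈ Ω) {K : Finset E3} (hK : K ∈ G.tets) {α : E3 → ℕ} (hα : α ∈ multiIndices p K)
    (hstar : starValue p V α ≠ 0) (hne : node p K α ≠ V) :
    G.lagrangeBasis p (node p K α) ∈ G.conformingSpaceWithoutVertices p := by
  classical
  have hopen : IsOpen Ω := by rw [hΩ]; exact isOpen_interior
  have hT := isTet_of_mem_tets hK
  have hp' : (0 : ℝ) < p := by exact_mod_cast (by omega : 0 < p)
  obtain ⟨hsum, hsub⟩ := Finset.mem_piAntidiag.1 hα
  have hαV : α V ≠ 0 := fun h => hstar (starValue_eq_zero h)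
  have h4 : (Function.support α).ncard < 4 := by
    by_contra h
    refine hstar ?_
    unfold starValue
    rw [if_pos (Or.inr (not_lt.1 h))]
  have hsupp := support_multiIndex hα
  set s := K.filter fun v => α v ≠ 0 with hs
  rw [hsupp, Set.ncard_coe_finset] at h4
  have hsK : s ⊆ K := Finset.filter_subset _ _
  have hVs : V ∈ s := Finset.mem_filter.2 ⟨hsub V hαV, hαV⟩
  -- A support consisting of V alone would force the node to be V itself.
  have h1 : s.card ≠ 1 := by
    intro h
    obtain ⟨u, hu⟩ := Finset.card_eq_one.1 h
    rw [hu, Finset.mem_singleton] at hVs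
    subst hVs
    have h0 : ∀ v ∈ K, v ≠ V → α v = 0 := fun v hv hvV => by
      by_contra hv0
      have : v ∈ s := Finset.mem_filter.2 ⟨hv, hv0⟩
      rw [hu, Finset.mem_singleton] at this
      exact hvV this
    have hVK := hsub V hαV
    have hp0 : α V = p := by
      rw [← hsum]
      exact (Finset.sum_eq_single_of_mem V hVK h0).symm
    apply hne
    unfold node
    rw [Finset.sum_eq_single_of_mem V hVK fun v hv hvV => by rw [h0 v hv hvV]; simp, hp0,
      div_self hp'.ne', one_smul]
  have h0 : 0 < s.card := Finset.card_pos.2 ⟨V, hVs⟩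
  have hb := hT.bary_node hp hα
  have hNK := hT.node_mem_convexHull hp hα
  have hbpos : ∀ v ∈ s, 0 < bary K v (node p K α) := fun v hv => by
    rw [hb]
    exact div_pos (by exact_mod_cast Nat.pos_of_ne_zero (Finset.mem_filter.1 hv).2) hp'
  have hNs : node p K α ∈ convexHull ℝ (s : Set E3) :=
    (hT.mem_convexHull_face_iff hsK).2 ⟨hNK, fun v hv => by
      have : α v = 0 := by
        by_contra h
        exact hv (Finset.mem_filter.2 ⟨hsub v h, h⟩)
      rw [hb, this]
      simp⟩
  have hinner : node p K α ∈ G.innerNodes p :=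
    ⟨⟨K, hK, α, hα, rfl⟩, mem_of_bary_pos hΩ hV hK hNK (hbpos V hVs)⟩
  have hmem : G.lagrangeBasis p (node p K α) ∈ G.conformingPart p s :=
    Submodule.subset_span ⟨_, ⟨hT.mem_intrinsicInterior_convexHull_face hsK hNs hbpos, hinner⟩, rfl⟩
  have hsimp : s ∈ G.innerSimplices s.card := by
    refine Finset.mem_filter.2 ⟨mem_simplices.2 ⟨G.complex.down_closed (mem_faces_of_mem_tets hK)
      hsK ⟨V, hVs⟩, rfl⟩, fun h => ?_⟩
    have := h (subset_convexHull ℝ _ (Finset.mem_coe.2 hVs))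
    rw [hopen.frontier_eq] at this
    exact this.2 hV
  unfold conformingSpaceWithoutVertices
  -- The node lies in the relative interior of an edge or a facet through V, which is inner because
  -- V is in Ω.
  rcases (by omega : s.card = 2 ∨ s.card = 3) with h | h <;> rw [h] at hsimp
  · exact Submodule.mem_sup_left (Submodule.mem_sup_left
      (Submodule.mem_iSup_of_mem s (Submodule.mem_iSup_of_mem hsimp hmem)))
  · exact Submodule.mem_sup_left (Submodule.mem_sup_right
      (Submodule.mem_iSup_of_mem s (Submodule.mem_iSup_of_mem hsimp hmem)))

open Classical in
lemma smul_sum_reflBasis (a : ℝ) (V : E3) :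
    a • ∑ T ∈ G.innerFacets with V ∈ T, G.reflBasis p 0 T =
      G.piecewiseInterp p fun K N => a * ∑ T ∈ G.innerFacets with V ∈ T,
        if T ⊆ K then reflValue p 0 T K N else 0 := by
  rw [piecewiseInterp_smul, piecewiseInterp_sum]
  rfl

open Classical in
lemma eq_single_of_node_eq (hp : 1 ≤ p) {V : E3} (hV : V ∈ G.vertices) {K : Finset E3}
    (hK : K ∈ G.tets) {α : E3 → ℕ} (hα : α ∈ multiIndices p K)
    (h : node p K α = V) : α = Pi.single V p := by
  have hp' : (p : ℝ) ≠ 0 := by exact_mod_cast (by omega : p ≠ 0)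
  obtain ⟨K', hK', hVK'⟩ := exists_tet_of_mem_vertices hV
  refine multiIndices_eq_of_node_eq hp hK hK' hα (Finset.mem_piAntidiag.2 ⟨?_, fun u hu => ?_⟩) ?_
  · rw [Finset.sum_eq_single V (fun u _ hu => Pi.single_eq_of_ne hu _) (fun h => absurd hVK' h),
      Pi.single_eq_same]
  · by_contra hu'
    exact hu (Pi.single_eq_of_ne (fun e : u = V => hu' (e.symm ▸ hVK')) _)
  · rw [h]
    unfold node
    rw [Finset.sum_eq_single_of_mem V hVK' fun v _ hvV => by rw [Pi.single_eq_of_ne hvV]; simp,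
      Pi.single_eq_same, div_self hp', one_smul]

-- The difference is expanded in the Lagrange basis: the choice of c cancels the coefficient at V,
-- and the other nonzero coefficients sit inside edges and facets.
open Classical in
theorem lagrangeBasis_sub_mem (hΩ : Ω = interior (closure Ω)) (hp : 1 ≤ p) {V : E3}
    (hV : V ∈ G.innerVertices) {c : ℝ} (hc : c * (edgePoly p 0 - edgePoly p 1) = 1) :
    G.lagrangeBasis p V - c • ∑ T ∈ G.innerFacets with V ∈ T, G.reflBasis p 0 T ∈
      G.conformingSpaceWithoutVertices p := by
  have hopen : IsOpen Ω := by rw [hΩ]; exact isOpen_interior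
  obtain ⟨W, hW⟩ := exists_nodal_function (G := G) hp (starValue p V)
  have e : c • ∑ T ∈ G.innerFacets with V ∈ T, G.reflBasis p 0 T =
      G.piecewiseInterp p fun _ N => c * W N := by
    rw [smul_sum_reflBasis]
    refine piecewiseInterp_congr fun K hK α hα => ?_
    rw [sum_reflValue hopen hp hV.2 hK hα, hW K hK α hα]
  have e2 : G.lagrangeBasis p V - c • ∑ T ∈ G.innerFacets with V ∈ T, G.reflBasis p 0 T =
      G.piecewiseInterp p fun _ N => (if N = V then 1 else 0) - c * W N := by
    rw [e, sub_eq_iff_eq_add, ← piecewiseInterp_add]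
    simp only [sub_add_cancel]
    rfl
  rw [e2, piecewiseInterp_eq_sum_lagrangeBasis fun N => (if N = V then 1 else 0) - c * W N]
  refine Submodule.sum_mem _ fun N hN => ?_
  obtain ⟨K, hK, α, hα, rfl⟩ := mem_nodeFinset.1 hN
  rw [hW K hK α hα]
  by_cases hNV : node p K α = V
  · rw [if_pos hNV, eq_single_of_node_eq hp hV.1 hK hα hNV, starValue_single hp, hc,
      sub_self, zero_smul]
    exact Submodule.zero_mem _
  · by_cases h0 : starValue p V α = 0
    · rw [if_neg hNV, h0, mul_zero, sub_self, zero_smul]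
      exact Submodule.zero_mem _
    · exact Submodule.smul_mem _ _
        (lagrangeBasis_mem_of_starValue_ne_zero hΩ hp hV.2 hK hα h0 hNV)

open Classical in
theorem exists_conforming_reflection_sum (hΩ : Ω = interior (closure Ω)) (hp : 1 ≤ p) {V : E3}
    (hV : V ∈ G.innerVertices) {c : ℝ} (hc : c * (edgePoly p 0 - edgePoly p 1) = 1) :
    ∃ f : E3 → ℝ,
      c • ∑ T ∈ G.innerFacets with V ∈ T, G.reflBasis p 0 T =ᵐ[volume.restrict Ω] f ∧
      G.IsConforming p f ∧ ∀ V' ∈ G.vertices, f V' = if V' = V then 1 else 0 := by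
  have hopen : IsOpen Ω := by rw [hΩ]; exact isOpen_interior
  refine ⟨G.glue (interp p fun α => c * starValue p V α), ?_,
    isConforming_glue hopen (interp_starValue_eq_zero hΩ hV.2 c), fun V' hV' => ?_⟩
  · rw [smul_sum_reflBasis]
    refine piecewiseInterp_ae_eq_glue hopen fun K hK α hα => ?_
    rw [sum_reflValue hopen hp hV.2 hK hα]
  · obtain ⟨K, hK, hVK⟩ := exists_tet_of_mem_vertices hV'
    rw [glue_eq (interp_compatible _) hK (subset_convexHull ℝ _ (Finset.mem_coe.2 hVK)),
      interp_vertex _ (isTet_of_mem_tets hK) hVK]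
    split_ifs with h
    · rw [h, starValue_single hp, hc]
    · rw [starValue_eq_zero (Pi.single_eq_of_ne (Ne.symm h) _), mul_zero]

open Classical in
lemma smul_sum_reflBasis_mem_reflSpaceUpTo (c : ℝ) (V : E3) :
    c • ∑ T ∈ G.innerFacets with V ∈ T, G.reflBasis p 0 T ∈ G.reflSpaceUpTo p 0 :=
  Submodule.smul_mem _ _ (Submodule.sum_mem _ fun T hT =>
    Submodule.mem_iSup_of_mem T (Submodule.mem_iSup_of_mem (Finset.mem_filter.1 hT).1
      (Submodule.subset_span ⟨0, le_refl 0, rfl⟩)))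

lemma reflSpaceUpTo_zero_le_reflSpace (hp : 1 ≤ p) : G.reflSpaceUpTo p 0 ≤ G.reflSpace p := by
  refine iSup₂_mono fun T _ => Submodule.span_mono (Set.image_mono fun k hk => ?_)
  have h0 : k = 0 := Nat.le_zero.1 hk
  change k < (p + 2) / 3
  omega

end TetMesh

end

/-! ### The vertex functions and the failure of directness. -/

open Classical in
theorem mainTheorem6 (Ω : Set E3) (hΩ : Ω = interior (closure Ω)) (G : TetMesh Ω)
    (p : ℕ) (hp : 1 ≤ p) :
    (∀ V ∈ G.innerVertices,
      G.lagrangeBasis p V ∈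
        G.symSpace p ⊔ G.reflSpaceUpTo p 0 ⊔ G.conformingSpaceWithoutVertices p ∧
      ∃ c : ℝ, c ≠ 0 ∧ ∃ f : E3 → ℝ,
        c • ∑ T ∈ G.innerFacets with V ∈ T, G.reflBasis p 0 T =ᵐ[volume.restrict Ω] f ∧
        G.IsConforming p f ∧
        (∀ V' ∈ G.vertices, f V' = if V' = V then 1 else 0) ∧
        G.lagrangeBasis p V - c • ∑ T ∈ G.innerFacets with V ∈ T, G.reflBasis p 0 T ∈
          G.conformingSpaceWithoutVertices p) ∧
    (G.innerVertices.Nonempty → ¬ Disjoint (G.conformingSpace p) (G.reflSpace p)) := by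
  have hopen : IsOpen Ω := by rw [hΩ]; exact isOpen_interior
  have hne := sub_ne_zero.2 (CrouzeixRaviart.edgePoly_zero_ne_one hp)
  have hc := inv_mul_cancel₀ hne
  refine ⟨fun V hV => ⟨?_, _, inv_ne_zero hne, ?_⟩, ?_⟩
  · have h1 := TetMesh.lagrangeBasis_sub_mem hΩ hp hV hc
    have h2 := TetMesh.smul_sum_reflBasis_mem_reflSpaceUpTo (G := G) (p := p)
      (CrouzeixRaviart.edgePoly p 0 - CrouzeixRaviart.edgePoly p 1)⁻¹ V
    -- The symmetric space contributes nothing here; the other two summands suffice.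
    have h3 := Submodule.add_mem_sup
      (Submodule.mem_sup_right (S := G.symSpace p) h2) h1
    rwa [add_sub_cancel] at h3
  · obtain ⟨f, h1, h2, h3⟩ := TetMesh.exists_conforming_reflection_sum hΩ hp hV hc
    exact ⟨f, h1, h2, h3, TetMesh.lagrangeBasis_sub_mem hΩ hp hV hc⟩
  · rintro ⟨V, hV⟩ hdisj
    obtain ⟨f, h1, h2, h3⟩ := TetMesh.exists_conforming_reflection_sum hΩ hp hV hc
    have h4 := Submodule.disjoint_def.1 hdisj _ ⟨f, h2, h1⟩
      (TetMesh.reflSpaceUpTo_zero_le_reflSpace hp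
        (TetMesh.smul_sum_reflBasis_mem_reflSpaceUpTo _ V))
    rw [h4] at h1
    have h5 : f =ᵐ[volume.restrict Ω] fun _ => 0 := h1.symm.trans AEEqFun.coeFn_zero
    -- Continuity on the open set Ω upgrades vanishing almost everywhere to vanishing at V, where f
    -- equals 1.
    have h6 := Measure.eqOn_open_of_ae_eq h5 hopen (h2.1.mono subset_closure) continuousOn_const
      hV.2
    rw [h3 V hV.1, if_pos rfl] at h6
    exact one_ne_zero h6
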